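/- **Conventions.** A precubical set $P=(P_n)_{n\ge 0}$ is a graded set with face operators $d^k_i\colon P_n\to P_{n-1}$ ($n\ge 1$, $k\in\{0,1\}$, $1\le i\le n$) such that $d^k_i d^l_j=d^l_{j-1}d^k_i$ for $i<j$; $|P|$ is its geometric realization. For $x\in P_n$, let $x_\sharp\colon [\![0,1]\!]^{\otimes n}\to P$ be the unique morphism from the precubical $n$-cube that sends the top element to $x$; $x$ is *regular* if $x_\sharp$ is injective. The *star* of $x$ is $\mathrm{star}(x)=\{y\in P : x\in y_\sharp([\![0,1]\!]^{\otimes \deg y})\}$; its complement is a precubical subset of $P$. A path is a morphism $[\![0,k]\!]\to P$; $v\to_P w$ means that there is a path in $P$ from the vertex $v$ to the vertex $w$. Dihomotopy of paths is the equivalence relation generated by replacing, inside a path, $d^0_1z\cdot d^1_2z$ by $d^0_2z\cdot d^1_1z$ for some $z\in P_2$; the fundamental category $\vec\pi_1(P)$ has the vertices as objects and the dihomotopy classes of paths as morphisms. Let $m_0(P)$ (resp. $m_1(P)$) be the set of vertices that are not of the form $d^0_1e$ (resp. $d^1_1e$) with $e\in P_1$. For a monoid $M$, an $M$-HDA is a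 tuple $\mathcal A=(P,I,F,\lambda)$ with a precubical set $P$, sets $I,F\subseteq P_0$ of initial and final states, and a map $\lambda\colon P_1\to M$ with $\lambda(d^0_iz)=\lambda(d^1_iz)$ for all $z\in P_2$, $i\in\{1,2\}$. It is *accessible* (*coaccessible*) if for every vertex $w$ there is a vertex $v\in I$ with $v\to_P w$ (a vertex $v\in F$ with $w\to_P v$). Its trace category $TC(\mathcal A)$ is the full subcategory of $\vec\pi_1(P)$ on $I\cup F\cup m_0(P)\cup m_1(P)$. A *weak morphism* from $Q$ to $P$ is a continuous map $f\colon|Q|\to|P|$ that sends every vertex $v\in Q_0$ to a vertex $f_0(v)\in P_0$ and such that for all integers $n,k_1,\dots,k_n\ge 1$ and every morphism $\xi\colon[\![0,k_1]\!]\otimes\cdots\otimes[\![0,k_n]\!]\to Q$ there are integers $l_1,\dots,l_n\ge 1$, a morphism $\chi\colon[\![0,l_1]\!]\otimes\cdots\otimes[\![0,l_n]\!]\to P$ and a homeomorphism $\phi\colon\prod_i[0,k_i]\to\prod_i[0,l_i]$ with $f\circ|\xi|=|\chi|\circ\phi$ such that $\phi$ and $\phi^{-1}$ preserve the natural partial order.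 For a path $\omega$ in $Q$ from $v$ to $w$, $f^{\mathbb I}(\omega)$ is the unique path $\nu$ in $P$ from $f_0(v)$ to $f_0(w)$ with $f\circ|\omega|=|\nu|\circ\phi$ for an increasing homeomorphism $\phi$ of intervals, and $f_*\colon\vec\pi_1(Q)\to\vec\pi_1(P)$ is the functor $v\mapsto f_0(v)$, $[\omega]\mapsto[f^{\mathbb I}(\omega)]$. A weak morphism of $M$-HDAs from $(Q,J,G,\mu)$ to $(P,I,F,\lambda)$ is a weak morphism $f$ from $Q$ to $P$ with $f_0(J)\subseteq I$, $f_0(G)\subseteq F$ that preserves the labels of paths, $\overline\lambda(f^{\mathbb I}(\omega))=\overline\mu(\omega)$, where the label of a path is the product of the labels of its edges. Let $H_*$ denote singular homology with coefficients in a fixed, arbitrary commutative unital ring. For homology classes $\alpha,\beta\in H_*(|P|)$ (possibly of different degrees) write $\alpha\nearrow\beta$ if there are precubical subsets $X,Y\subseteq P$ such that $\alpha$ lies in the image of $H_*(|X|)$, $\beta$ lies in the image of $H_*(|Y|)$, and $a\to_P b$ for all vertices $a\in X_0$, $b\in Y_0$. The homology graph of $P$ has the homology classes of $|P|$ as vertices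 and $\nearrow$ as edge relation. An $M$-HDA $\mathcal B=(Q,J,G,\mu)$ is a *topological abstraction* of $\mathcal A=(P,I,F,\lambda)$, written $\mathcal B\stackrel{\sim}{\to}\mathcal A$, if there is a weak morphism $f$ from $\mathcal B$ to $\mathcal A$ such that (1) $f_0(J)=I$, $f_0(G)=F$, $f_0(m_0(Q))=m_0(P)$ and $f_0(m_1(Q))=m_1(P)$; (2) $f$ is a homotopy equivalence; (3) $f_*\colon TC(\mathcal B)\to TC(\mathcal A)$ is an isomorphism of categories; (4) $f_*\colon H_*(|Q|)\to H_*(|P|)$ is an isomorphism of homology graphs. **Theorem.** Let $\mathcal A=(P,I,F,\lambda)$ be an $M$-HDA, let $x\in P_n$ be a regular element of degree $n\ge 2$, and let $k_1,\dots,k_n\in\{0,1\}$ be numbers, at least one of which is $0$ and at least one of which is $1$. Put $v=d^{k_n}_1\cdots d^{k_1}_1x$, and suppose that $v\notin I\cup F$ and $\mathrm{star}(v)\subseteq x_\sharp([\![0,1]\!]^{\otimes n})$. Let $Q=P\setminus\mathrm{star}(v)$ and $\mathcal B=(Q,I,F,\lambda|_{Q_1})$. Then $\mathcal B\stackrel{\sim}{\to}\mathcal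 A$. Moreover, $\mathcal A$ is accessible if and only if $\mathcal B$ is accessible, and $\mathcal A$ is coaccessible if and only if $\mathcal B$ is coaccessible. -/

import Mathlib

open CategoryTheory

universe u v w

/-! ### Precubical sets -/

/-- A precubical set: a graded set with face operators `d^ε_i` (`ε = false` for `0`, the front
faces, and `ε = true` for `1`, the back faces).  The index `i` is counted from `0`, so the relation
`d^k_i d^l_j = d^l_{j-1} d^k_i` (`i < j`) is written with `j` replaced by `j + 1`. -/
structure PrecubicalSet where
  cells : ℕ → Type u
  face : ∀ {n : ℕ}, Bool → Fin (n + 1) → cells (n + 1) → cells n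
  face_face : ∀ {n : ℕ} (k l : Bool) (i j : Fin (n + 1)), i ≤ j → ∀ x : cells (n + 2),
    face k i (face l j.succ x) = face l j (face k i.castSucc x)

namespace PrecubicalSet

/-- Morphisms of precubical sets. -/
structure Hom (P : PrecubicalSet.{u}) (Q : PrecubicalSet.{v}) where
  app : ∀ {n : ℕ}, P.cells n → Q.cells n
  app_face : ∀ {n : ℕ} (ε : Bool) (i : Fin (n + 1)) (x : P.cells (n + 1)),
    app (P.face ε i x) = Q.face ε i (app x)

/-! ### Tensor products of precubical intervals -/

/-- The elements of degree `m` of `⟦0, k₁⟧ ⊗ ⋯ ⊗ ⟦0, kₙ⟧`: sequences whose entry at position `i` is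
a vertex `a ∈ {0, …, kᵢ}` or an edge `[a, a + 1]` with `a ∈ {0, …, kᵢ - 1}` of `⟦0, kᵢ⟧`, exactly
`m` of the entries being edges. -/
inductive GridCell : (n : ℕ) → (Fin n → ℕ) → ℕ → Type
  | nil {k : Fin 0 → ℕ} : GridCell 0 k 0
  | vertex {n : ℕ} {k : Fin (n + 1) → ℕ} {m : ℕ} (a : Fin (k 0 + 1))
      (c : GridCell n (Fin.tail k) m) : GridCell (n + 1) k m
  | edge {n : ℕ} {k : Fin (n + 1) → ℕ} {m : ℕ} (a : Fin (k 0))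
      (c : GridCell n (Fin.tail k) m) : GridCell (n + 1) k (m + 1)

/-- The end `d^ε [a, a + 1]` of an edge of `⟦0, k⟧`. -/
def intervalEnd {k : ℕ} (ε : Bool) (a : Fin k) : Fin (k + 1) :=
  if ε then a.succ else a.castSucc

/-- `d^ε_j` replaces the `j`-th edge entry by its initial or final vertex. -/
def GridCell.face : ∀ {n : ℕ} {k : Fin n → ℕ} {m : ℕ}, Bool → Fin (m + 1) →
    GridCell n k (m + 1) → GridCell n k m
  | _, _, _, ε, j, .vertex a c => .vertex a (c.face ε j)
  | _, _, 0, ε, _, .edge a c => .vertex (intervalEnd ε a) c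
  | _, _, _ + 1, ε, j, .edge a c =>
      Fin.cases (.vertex (intervalEnd ε a) c) (fun j' => .edge a (c.face ε j')) j

theorem GridCell.face_vertex {n : ℕ} {k : Fin (n + 1) → ℕ} {m : ℕ} (ε : Bool) (j : Fin (m + 1))
    (a : Fin (k 0 + 1)) (c : GridCell n (Fin.tail k) (m + 1)) :
    (GridCell.vertex a c).face ε j = .vertex a (c.face ε j) := by
  cases m <;> simp [GridCell.face]

theorem GridCell.face_edge_zero {n : ℕ} {k : Fin (n + 1) → ℕ} {m : ℕ} (ε : Bool)
    (a : Fin (k 0)) (c : GridCell n (Fin.tail k) m) :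
    (GridCell.edge a c).face ε 0 = .vertex (intervalEnd ε a) c := by
  cases m <;> simp [GridCell.face]

theorem GridCell.face_edge_succ {n : ℕ} {k : Fin (n + 1) → ℕ} {m : ℕ} (ε : Bool)
    (j : Fin (m + 1)) (a : Fin (k 0)) (c : GridCell n (Fin.tail k) (m + 1)) :
    (GridCell.edge a c).face ε j.succ = .edge a (c.face ε j) := by
  simp [GridCell.face]

theorem GridCell.face_face {n : ℕ} {k : Fin n → ℕ} {m : ℕ} (ε δ : Bool) (i j : Fin (m + 1))
    (hij : i ≤ j) (c : GridCell n k (m + 2)) :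
    (c.face δ j.succ).face ε i = (c.face ε i.castSucc).face δ j := by
  induction n generalizing m with
  | zero => cases c
  | succ n ih =>
    cases c with
    | vertex a c => simp [GridCell.face_vertex, ih i j hij c]
    | edge a c =>
      rw [GridCell.face_edge_succ]
      induction i using Fin.cases with
      | zero => simp [GridCell.face_edge_zero, GridCell.face_vertex]
      | succ i =>
        induction j using Fin.cases with
        | zero => simp at hij
        | succ j =>
          cases m with
          | zero => exact i.elim0
          | succ m =>
            rw [Fin.castSucc_succ, GridCell.face_edge_succ, GridCell.face_edge_succ,
              GridCell.face_edge_succ, ih i j (by simpa using hij) c]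

/-- The precubical set `⟦0, k₁⟧ ⊗ ⋯ ⊗ ⟦0, kₙ⟧`. -/
def grid {n : ℕ} (k : Fin n → ℕ) : PrecubicalSet.{0} where
  cells := GridCell n k
  face := GridCell.face
  face_face ε δ i j h c := GridCell.face_face ε δ i j h c

/-- The precubical `n`-cube `⟦0, 1⟧^{⊗ n}`. -/
abbrev cube (n : ℕ) : PrecubicalSet.{0} := grid (fun _ : Fin n => 1)

/-- The unique element `ι_n` of degree `n` of the `n`-cube. -/
def topCell : ∀ n : ℕ, (cube n).cells n
  | 0 => GridCell.nil
  | n + 1 => GridCell.edge (0 : Fin 1) (topCell n)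

/-! ### The morphism `x_♯`, regularity, stars -/

/-- The precubical set with elements `P_{n+1}` in degree `n` and with the face operators
`d^ε_2, …, d^ε_{n+1}`. -/
def shift (P : PrecubicalSet.{u}) : PrecubicalSet.{u} where
  cells n := P.cells (n + 1)
  face ε i x := P.face ε i.succ x
  face_face k l i j h x := by
    have := P.face_face k l i.succ j.succ (by simpa using h) x
    simpa using this

/-- The map `x_♯ : ⟦0, 1⟧^{⊗ n} → P`: the entries of `c` are read from left to right; a vertex entry
`ε` applies the face operator `d^ε` in the direction of the entry, an edge entry leaves the
direction alone. -/
def sharp : ∀ {n m : ℕ} (_ : (cube n).cells m) (P : PrecubicalSet.{u}) (_ : P.cells n), P.cells m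
  | _, _, .nil, _, x => x
  | _, _, .vertex a c, P, x => sharp c P (P.face (decide (a.val = 1)) 0 x)
  | _, _, .edge _ c, P, x => sharp c P.shift x

theorem sharp_naturality {n m : ℕ} (c : (cube n).cells m) {P Q : PrecubicalSet.{u}} (f : Hom P Q)
    (x : P.cells n) : f.app (sharp c P x) = sharp c Q (f.app x) := by
  induction n generalizing m P Q with
  | zero => cases c; simp [sharp]
  | succ n ih =>
    cases c with
    | vertex a c => simp only [sharp]; rw [ih c f, f.app_face]
    | edge a c =>
      simp only [sharp]
      exact ih c (P := P.shift) (Q := Q.shift)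
        ⟨fun y => f.app y, fun ε i y => f.app_face ε i.succ y⟩ x

/-- `d^ε_1`, seen as a morphism from the shifted precubical set. -/
def shiftFace (P : PrecubicalSet.{u}) (ε : Bool) : Hom P.shift P where
  app x := P.face ε 0 x
  app_face δ i x := by
    have := P.face_face ε δ 0 i (Fin.zero_le _) x
    simpa [shift] using this

theorem sharp_face {n m : ℕ} (ε : Bool) (j : Fin (m + 1)) (c : (cube n).cells (m + 1))
    (P : PrecubicalSet.{u}) (x : P.cells n) :
    sharp ((cube n).face ε j c) P x = P.face ε j (sharp c P x) := by
  induction n generalizing m P with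
  | zero => cases c
  | succ n ih =>
    cases c with
    | vertex a c =>
      change sharp (GridCell.face ε j (.vertex a c)) P x = _
      rw [GridCell.face_vertex]
      simp only [sharp]
      exact ih j c P _
    | edge a c =>
      change sharp (GridCell.face ε j (.edge a c)) P x = _
      induction j using Fin.cases with
      | zero =>
        rw [GridCell.face_edge_zero]
        simp only [sharp]
        have h := sharp_naturality c (shiftFace P ε) x
        have ha : a = 0 := Subsingleton.elim (α := Fin 1) _ _
        subst ha
        cases ε <;> simpa [intervalEnd, shiftFace] using h.symm
      | succ j =>
        cases m with
        | zero => exact j.elim0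
        | succ m =>
          rw [GridCell.face_edge_succ]
          simp only [sharp]
          exact ih j c P.shift x

theorem sharp_topCell {n : ℕ} (P : PrecubicalSet.{u}) (x : P.cells n) :
    sharp (topCell n) P x = x := by
  induction n generalizing P with
  | zero => rfl
  | succ n ih => exact ih P.shift x

/-- The morphism of precubical sets `x_♯ : ⟦0, 1⟧^{⊗ n} → P` with `ι_n ↦ x`. -/
def sharpHom (P : PrecubicalSet.{u}) {n : ℕ} (x : P.cells n) : Hom (cube n) P where
  app c := sharp c P x
  app_face ε i c := sharp_face ε i c P x

/-- `x` is regular if `x_♯` is injective. -/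
def IsRegular (P : PrecubicalSet.{u}) {n : ℕ} (x : P.cells n) : Prop :=
  ∀ m : ℕ, Function.Injective (fun c : (cube n).cells m => (P.sharpHom x).app c)

/-- The elements of degree `m` of `x_♯(⟦0, 1⟧^{⊗ n})`. -/
def cubeImage (P : PrecubicalSet.{u}) {n : ℕ} (x : P.cells n) (m : ℕ) : Set (P.cells m) :=
  Set.range (fun c : (cube n).cells m => (P.sharpHom x).app c)

/-- The elements of degree `m` of the star of `x`. -/
def star (P : PrecubicalSet.{u}) {n : ℕ} (x : P.cells n) (m : ℕ) : Set (P.cells m) :=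
  {y | x ∈ P.cubeImage y n}

/-- The vertex `d^{k_n}_1 ⋯ d^{k_1}_1 x`. -/
def corner (P : PrecubicalSet.{u}) : ∀ {n : ℕ}, (Fin n → Bool) → P.cells n → P.cells 0
  | 0, _, x => x
  | _ + 1, k, x => P.corner (Fin.tail k) (P.face (k 0) 0 x)

/-! ### Precubical subsets -/

/-- A precubical subset: a graded subset that is stable under the face operators. -/
structure Subset (P : PrecubicalSet.{u}) where
  carrier : ∀ n : ℕ, Set (P.cells n)
  face_mem : ∀ {n : ℕ} (ε : Bool) (i : Fin (n + 1)) {x : P.cells (n + 1)},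
    x ∈ carrier (n + 1) → P.face ε i x ∈ carrier n

/-- A precubical subset as a precubical set in its own right. -/
def Subset.toPrecubicalSet {P : PrecubicalSet.{u}} (X : P.Subset) : PrecubicalSet.{u} where
  cells n := X.carrier n
  face ε i x := ⟨P.face ε i x.1, X.face_mem ε i x.2⟩
  face_face k l i j h x := Subtype.ext (P.face_face k l i j h x.1)

/-- The inclusion of a precubical subset. -/
def Subset.incl {P : PrecubicalSet.{u}} (X : P.Subset) : Hom X.toPrecubicalSet P where
  app x := x.1
  app_face _ _ _ := rfl

/-- Every face of a face of `y` is a face of `y`. -/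
theorem exists_sharp_face {n m : ℕ} (c : (cube n).cells m) (ε : Bool) (i : Fin (n + 1)) :
    ∃ c' : (cube (n + 1)).cells m, ∀ (P : PrecubicalSet.{u}) (y : P.cells (n + 1)),
      sharp c' P y = sharp c P (P.face ε i y) := by
  have key : ∀ {n m : ℕ} (c : (cube n).cells m), ∃ c' : (cube (n + 1)).cells m,
      ∀ (P : PrecubicalSet.{u}) (y : P.cells (n + 1)),
        sharp c' P y = sharp c P (P.face ε 0 y) := by
    intro n m c
    refine ⟨GridCell.vertex (if ε then (1 : Fin 2) else (0 : Fin 2)) c, fun P y => ?_⟩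
    cases ε <;> simp [sharp]
  induction n generalizing m with
  | zero =>
    have hi : i = 0 := Subsingleton.elim (α := Fin 1) _ _
    subst hi
    exact key c
  | succ n ih =>
    induction i using Fin.cases with
    | zero => exact key c
    | succ i =>
      cases c with
      | vertex a c =>
        obtain ⟨c', hc'⟩ := ih c i
        refine ⟨GridCell.vertex a c', fun P y => ?_⟩
        simp only [sharp]
        rw [hc', P.face_face _ ε 0 i (Fin.zero_le _) y]
        rfl
      | edge a c =>
        obtain ⟨c', hc'⟩ := ih c i
        exact ⟨GridCell.edge a c', fun P y => hc' P.shift y⟩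

/-- The precubical subset `P ∖ star(x)`. -/
def starComplement (P : PrecubicalSet.{u}) {n : ℕ} (x : P.cells n) : P.Subset where
  carrier m := (P.star x m)ᶜ
  face_mem := by
    rintro m ε i y hy ⟨c, hc⟩
    obtain ⟨c', hc'⟩ := exists_sharp_face c ε i
    exact hy ⟨c', (hc' P y).trans hc⟩

/-! ### Geometric realization -/

/-- The coproduct of one cube `[0,1]^n` for every element of degree `n`. -/
abbrev PreRealization (P : PrecubicalSet.{u}) : Type u :=
  Σ c : (Σ n : ℕ, P.cells n), (Fin c.1 → unitInterval)

/-- The end `0` or `1` of the unit interval. -/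
def unitEnd (ε : Bool) : unitInterval := if ε then 1 else 0

/-- The identifications `(d^ε_i x, u) ∼ (x, δ^ε_i(u))`; `δ^ε_i` inserts `ε` at position `i`. -/
inductive RealizationRel (P : PrecubicalSet.{u}) : P.PreRealization → P.PreRealization → Prop
  | glue {n : ℕ} (x : P.cells (n + 1)) (ε : Bool) (i : Fin (n + 1)) (t : Fin n → unitInterval) :
      RealizationRel P ⟨⟨n, P.face ε i x⟩, t⟩
        ⟨⟨n + 1, x⟩, i.insertNth (α := fun _ => unitInterval) (unitEnd ε) t⟩

/-- The geometric realization `|P|`, with the quotient topology. -/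
def Realization (P : PrecubicalSet.{u}) : Type u := Quot P.RealizationRel

instance (P : PrecubicalSet.{u}) : TopologicalSpace P.Realization :=
  inferInstanceAs (TopologicalSpace (Quot P.RealizationRel))

/-- The point `[x, t]` of `|P|`. -/
def point (P : PrecubicalSet.{u}) {n : ℕ} (x : P.cells n) (t : Fin n → unitInterval) :
    P.Realization :=
  Quot.mk _ ⟨⟨n, x⟩, t⟩

/-- The point `[v, ()]` of `|P|` given by a vertex `v`. -/
def vertexPoint (P : PrecubicalSet.{u}) (x : P.cells 0) : P.Realization := P.point x Fin.elim0

/-- The continuous map `|f| : |P| → |Q|`, `[x, t] ↦ [f(x), t]`. -/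
def Hom.realization {P : PrecubicalSet.{u}} {Q : PrecubicalSet.{v}} (f : Hom P Q) :
    C(P.Realization, Q.Realization) where
  toFun := Quot.lift (fun p => Q.point (f.app p.1.2) p.2) (by
    rintro _ _ ⟨x, ε, i, t⟩
    simp only [f.app_face]
    exact Quot.sound (RealizationRel.glue (f.app x) ε i t))
  continuous_toFun := by
    refine continuous_quot_lift _ (continuous_sigma fun c => ?_)
    exact continuous_quot_mk.comp
      (continuous_sigmaMk (σ := fun c : (Σ n : ℕ, Q.cells n) => (Fin c.1 → unitInterval))
        (i := ⟨c.1, f.app c.2⟩))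

/-! ### Weak morphisms -/

/-- The point of `[0, k₁] × ⋯ × [0, kₙ]` with local coordinates `t` in the cell `c`. -/
def GridCell.coord : ∀ {n : ℕ} {k : Fin n → ℕ} {m : ℕ}, GridCell n k m →
    (Fin m → unitInterval) → (Fin n → ℝ)
  | _, _, _, .nil, _ => Fin.elim0
  | _, _, _, .vertex a c, t => Fin.cons (a.val : ℝ) (c.coord t)
  | _, _, _, .edge a c, t => Fin.cons ((a.val : ℝ) + (t 0 : ℝ)) (c.coord (Fin.tail t))

theorem GridCell.coord_face {n : ℕ} {k : Fin n → ℕ} {m : ℕ} (c : GridCell n k (m + 1)) (ε : Bool)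
    (i : Fin (m + 1)) (t : Fin m → unitInterval) :
    (c.face ε i).coord t =
      c.coord (i.insertNth (α := fun _ => unitInterval) (unitEnd ε) t) := by
  induction n generalizing m with
  | zero => cases c
  | succ n ih =>
    cases c with
    | vertex a c => rw [GridCell.face_vertex]; simp only [GridCell.coord]; rw [ih c]
    | edge a c =>
      induction i using Fin.cases with
      | zero =>
        rw [GridCell.face_edge_zero]
        simp only [GridCell.coord, Fin.insertNth_zero, Fin.cons_zero, Fin.tail_cons]
        cases ε <;> simp [intervalEnd, unitEnd]
      | succ i =>
        cases m with
        | zero => exact i.elim0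
        | succ m =>
          rw [GridCell.face_edge_succ]
          simp only [GridCell.coord]
          rw [ih c]
          have h0 : (i.succ.insertNth (α := fun _ => unitInterval) (unitEnd ε) t) 0 = t 0 := by
            have h := Fin.insertNth_apply_succAbove (α := fun _ => unitInterval) i.succ
              (unitEnd ε) t 0
            simpa using h
          have h1 : Fin.tail (i.succ.insertNth (α := fun _ => unitInterval) (unitEnd ε) t) =
              i.insertNth (α := fun _ => unitInterval) (unitEnd ε) (Fin.tail t) := by
            rw [← Fin.cons_self_tail t]
            rw [Fin.insertNth_succ_cons]
            simp
          rw [h0, h1]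

/-- The identification `|⟦0, k₁⟧ ⊗ ⋯ ⊗ ⟦0, kₙ⟧| = [0, k₁] × ⋯ × [0, kₙ] ⊆ ℝⁿ`. -/
def gridCoord {n : ℕ} (k : Fin n → ℕ) : (grid k).Realization → (Fin n → ℝ) :=
  Quot.lift (fun p => GridCell.coord p.1.2 p.2) (by
    rintro _ _ ⟨x, ε, i, t⟩
    exact GridCell.coord_face x ε i t)

/-- A dihomeomorphism between realizations of grids: a homeomorphism that, together with its
inverse, preserves the natural partial order of `ℝⁿ`. -/
def IsDihomeomorphism {n : ℕ} {k l : Fin n → ℕ} (φ : (grid k).Realization ≃ₜ (grid l).Realization) :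
    Prop :=
  ∀ s t, gridCoord l (φ s) ≤ gridCoord l (φ t) ↔ gridCoord k s ≤ gridCoord k t

/-- A weak morphism of precubical sets from `Q` to `P`.  The vertex map `f₀` is uniquely determined
by the underlying continuous map. -/
structure WeakMorphism (Q P : PrecubicalSet.{u}) where
  map : C(Q.Realization, P.Realization)
  vertexMap : Q.cells 0 → P.cells 0
  map_vertex : ∀ x : Q.cells 0, map (Q.vertexPoint x) = P.vertexPoint (vertexMap x)
  exists_grid : ∀ (n : ℕ) (k : Fin n → ℕ), 1 ≤ n → (∀ i, 1 ≤ k i) → ∀ ξ : Hom (grid k) Q,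
    ∃ (l : Fin n → ℕ) (χ : Hom (grid l) P) (φ : (grid k).Realization ≃ₜ (grid l).Realization),
      (∀ i, 1 ≤ l i) ∧ IsDihomeomorphism φ ∧
        ∀ s, map (ξ.realization s) = χ.realization (φ s)

/-! ### Paths -/

/-- The vertices of `P`. -/
abbrev Vertex (P : PrecubicalSet.{u}) : Type u := P.cells 0

/-- An arrow `a ⟶ b` is an element `e` of degree `1` with `d^0_1 e = a` and `d^1_1 e = b`. -/
instance (P : PrecubicalSet.{u}) : Quiver.{u} P.Vertex where
  Hom a b := {e : P.cells 1 // P.face false 0 e = a ∧ P.face true 0 e = b}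

/-- The (finite) paths of `P` from `a` to `b`: a path of length `k`, that is, a morphism
`⟦0, k⟧ → P`, is given by its initial vertex and the sequence of its `k` edges. -/
abbrev Path (P : PrecubicalSet.{u}) (a b : P.Vertex) : Type u := Quiver.Path a b

/-- `a →_P b`: the vertex `b` is accessible from `a`. -/
def Reach (P : PrecubicalSet.{u}) (a b : P.cells 0) : Prop :=
  Nonempty (P.Path a b)

/-- The map `|ω| : [0, length ω] → |P|` (extended to `ℝ` in an irrelevant way): for
`t ∈ [j, j + 1]`, the value is the point `[e, t - j]` of the `(j + 1)`-st edge `e` of `ω`. -/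
noncomputable def pathRealization (P : PrecubicalSet.{u}) {a : P.Vertex} :
    ∀ {b : P.Vertex}, P.Path a b → ℝ → P.Realization
  | _, .nil => fun _ => P.vertexPoint a
  | _, .cons p e => fun t =>
      if t ≤ p.length then P.pathRealization p t
      else P.point e.1 (fun _ => Set.projIcc (0 : ℝ) 1 zero_le_one (t - p.length))

/-- The map `ω ↦ f^𝕀(ω)` on paths: the path `f^𝕀(ω)` leads from `f₀(a)` to `f₀(b)` if `ω` leads from
`a` to `b`, and `f ∘ |ω| = |f^𝕀(ω)| ∘ φ` for a dihomeomorphism `φ` of intervals.  It is uniquely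
determined by `f`. -/
structure PathMap {Q P : PrecubicalSet.{u}} (f : WeakMorphism Q P) where
  map : ∀ {a b : Q.Vertex}, Q.Path a b →
    P.Path (f.vertexMap a) (f.vertexMap b)
  spec : ∀ {a b : Q.Vertex} (ω : Q.Path a b),
    ∃ φ : Set.Icc (0 : ℝ) ω.length ≃ₜ Set.Icc (0 : ℝ) (map ω).length,
      (∀ s t, φ s ≤ φ t ↔ s ≤ t) ∧
        ∀ t : Set.Icc (0 : ℝ) ω.length,
          f.map (Q.pathRealization ω (t : ℝ)) = P.pathRealization (map ω) (φ t : ℝ)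

/-! ### The fundamental category -/

/-- The two paths `(d^0_1 z)·(d^1_2 z)` and `(d^0_2 z)·(d^1_1 z)` along the boundary of an element `z`
of degree `2` are related. -/
inductive SquareRel (P : PrecubicalSet.{u}) : HomRel (Paths P.Vertex)
  | square {a b b' c : P.Vertex} (z : P.cells 2) (e₁ : a ⟶ b) (e₂ : b ⟶ c) (g₁ : a ⟶ b')
      (g₂ : b' ⟶ c) (he₁ : e₁.1 = P.face false 0 z) (he₂ : e₂.1 = P.face true 1 z)
      (hg₁ : g₁.1 = P.face false 1 z) (hg₂ : g₂.1 = P.face true 0 z) :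
      SquareRel P (X := a) (Y := c) (e₁.toPath.comp e₂.toPath) (g₁.toPath.comp g₂.toPath)

/-- The fundamental category of `P`: its objects are the vertices and its morphisms are the
dihomotopy classes of paths.  Elementary dihomotopy is the closure of `SquareRel` under
concatenation with paths `α`, `β` on both sides, and dihomotopy is the equivalence relation it
generates. -/
abbrev FundamentalCategory (P : PrecubicalSet.{u}) : Type u := CategoryTheory.Quotient P.SquareRel

/-- The dihomotopy class of a path. -/
def dihomotopyClass (P : PrecubicalSet.{u}) {a b : P.Vertex} (ω : P.Path a b) :
    (⟨a⟩ : P.FundamentalCategory) ⟶ ⟨b⟩ :=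
  (CategoryTheory.Quotient.functor P.SquareRel).map (X := (a : Paths P.Vertex)) (Y := (b : Paths P.Vertex)) ω

/-- Compatibility of `f^𝕀` with constant paths, concatenation and dihomotopy. -/
structure PathMap.IsFunctorial {Q P : PrecubicalSet.{u}} {f : WeakMorphism Q P} (F : PathMap f) :
    Prop where
  map_nil : ∀ a : Q.Vertex, F.map (Quiver.Path.nil : Q.Path a a) = Quiver.Path.nil
  map_comp : ∀ {a b c : Q.Vertex} (ω : Q.Path a b) (ν : Q.Path b c),
    F.map (ω.comp ν) = (F.map ω).comp (F.map ν)
  map_dihomotopy : ∀ {a b : Q.Vertex} (ω ν : Q.Path a b),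
    Q.dihomotopyClass ω = Q.dihomotopyClass ν →
      P.dihomotopyClass (F.map ω) = P.dihomotopyClass (F.map ν)

/-- The functor `f_*` between fundamental categories, `f_*(v) = f₀(v)` and `f_*[ω] = [f^𝕀(ω)]`. -/
def PathMap.functor {Q P : PrecubicalSet.{u}} {f : WeakMorphism Q P} (F : PathMap f)
    (hF : F.IsFunctorial) : Q.FundamentalCategory ⥤ P.FundamentalCategory :=
  CategoryTheory.Quotient.lift Q.SquareRel
    { obj := fun a => ⟨(f.vertexMap a)⟩
      map := fun {a b} ω => P.dihomotopyClass (F.map (a := a) (b := b) ω)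
      map_id := fun a => by
        change P.dihomotopyClass (F.map (Quiver.Path.nil : Q.Path a a)) = _
        refine (congrArg _ (hF.map_nil a)).trans ?_
        exact (CategoryTheory.Quotient.functor P.SquareRel).map_id _
      map_comp := fun {a b c} ω ν => by
        refine (congrArg _ (hF.map_comp (a := a) (b := b) (c := c) ω ν)).trans ?_
        exact (CategoryTheory.Quotient.functor P.SquareRel).map_comp _ _ }
    (fun _ _ ω ν h => hF.map_dihomotopy ω ν (CategoryTheory.Quotient.sound Q.SquareRel h))

/-- The set `m_0(P)` of maximal vertices. -/
def maximalVertices (P : PrecubicalSet.{u}) : Set (P.cells 0) :=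
  {a | ¬ ∃ e : P.cells 1, P.face false 0 e = a}

/-- The set `m_1(P)` of minimal vertices. -/
def minimalVertices (P : PrecubicalSet.{u}) : Set (P.cells 0) :=
  {a | ¬ ∃ e : P.cells 1, P.face true 0 e = a}

/-! ### Homology -/

/-- Singular homology `H_n(X; R)`. -/
noncomputable def homology (R : Type w) [CommRing R] (n : ℕ) :
    TopCat.{u} ⥤ ModuleCat.{max u w} R :=
  (AlgebraicTopology.singularHomologyFunctor (ModuleCat.{max u w} R) n).obj
    (ModuleCat.of R (ULift.{u} R))

/-- The homology classes of degree `n` of `|P|`. -/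
noncomputable abbrev H (R : Type w) [CommRing R] (n : ℕ) (P : PrecubicalSet.{u}) :
    ModuleCat.{max u w} R :=
  (homology.{u, w} R n).obj (TopCat.of P.Realization)

/-- The map induced in homology by a continuous map `|Q| → |P|`. -/
noncomputable def homologyMap (R : Type w) [CommRing R] (n : ℕ) {Q P : PrecubicalSet.{u}}
    (f : C(Q.Realization, P.Realization)) : H R n Q → H R n P :=
  fun α => ((homology.{u, w} R n).map (TopCat.ofHom f)).hom α

/-- `α ↗ β`: the homology class `α` points to the homology class `β`. -/
def PointsTo (R : Type w) [CommRing R] (P : PrecubicalSet.{u}) {p q : ℕ} (α : H R p P)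
    (β : H R q P) : Prop :=
  ∃ X Y : P.Subset,
    α ∈ Set.range (homologyMap R p X.incl.realization) ∧
    β ∈ Set.range (homologyMap R q Y.incl.realization) ∧
    ∀ a ∈ X.carrier 0, ∀ b ∈ Y.carrier 0, P.Reach a b

/-- The map induced in homology is an isomorphism of homology graphs: a bijection between the
sets of homology classes which preserves and reflects the relation `↗`. -/
def IsHomologyGraphIso (R : Type w) [CommRing R] {Q P : PrecubicalSet.{u}}
    (f : C(Q.Realization, P.Realization)) : Prop :=
  (∀ n : ℕ, Function.Bijective (homologyMap R n f)) ∧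
  ∀ (p q : ℕ) (α : H R p Q) (β : H R q Q),
    PointsTo R Q α β ↔ PointsTo R P (homologyMap R p f α) (homologyMap R q f β)

end PrecubicalSet

open PrecubicalSet

/-! ### Higher-dimensional automata -/

/-- A higher-dimensional automaton over the monoid `M`. -/
structure HDA (M : Type v) [Monoid M] where
  P : PrecubicalSet.{u}
  init : Set (P.cells 0)
  final : Set (P.cells 0)
  label : P.cells 1 → M
  label_face : ∀ (i : Fin 2) (z : P.cells 2), label (P.face false i z) = label (P.face true i z)

namespace HDA

variable {M : Type v} [Monoid M]

/-- The extended labeling function. -/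
def pathLabel (A : HDA.{u} M) {a : A.P.Vertex} : ∀ {b : A.P.Vertex}, A.P.Path a b → M
  | _, .nil => 1
  | _, .cons p e => A.pathLabel p * A.label e.1

/-- Every vertex is accessible from an initial state. -/
def IsAccessible (A : HDA.{u} M) : Prop :=
  ∀ b : A.P.cells 0, ∃ a ∈ A.init, A.P.Reach a b

/-- From every vertex, a final state is accessible. -/
def IsCoaccessible (A : HDA.{u} M) : Prop :=
  ∀ a : A.P.cells 0, ∃ b ∈ A.final, A.P.Reach a b

/-- The HDA obtained by restriction to a precubical subset. -/
def restrict (A : HDA.{u} M) (X : A.P.Subset) : HDA.{u} M where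
  P := X.toPrecubicalSet
  init := {a | X.incl.app a ∈ A.init}
  final := {a | X.incl.app a ∈ A.final}
  label e := A.label (X.incl.app e)
  label_face i z := A.label_face i z.1

/-- A weak morphism of HDAs. -/
structure WeakMorphism (B A : HDA.{u} M) extends PrecubicalSet.WeakMorphism B.P A.P where
  pathMap : PathMap toWeakMorphism
  map_init : Set.MapsTo vertexMap B.init A.init
  map_final : Set.MapsTo vertexMap B.final A.final
  map_label : ∀ {a b : B.P.Vertex} (ω : B.P.Path a b),
    A.pathLabel (pathMap.map ω) = B.pathLabel ω

/-- The vertices `I ∪ F ∪ m_0(P) ∪ m_1(P)`, the objects of the trace category. -/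
def traceVertices (A : HDA.{u} M) : ObjectProperty A.P.FundamentalCategory :=
  fun a => (a.as : A.P.cells 0) ∈
    A.init ∪ A.final ∪ A.P.maximalVertices ∪ A.P.minimalVertices

/-- The trace category: the full subcategory of the fundamental category on `I ∪ F ∪ m_0 ∪ m_1`. -/
abbrev TraceCategory (A : HDA.{u} M) : Type u := A.traceVertices.FullSubcategory

/-- The functor `f_* : TC(B) ⥤ TC(A)`. -/
def WeakMorphism.traceFunctor {B A : HDA.{u} M} (f : WeakMorphism B A)
    (hf : f.pathMap.IsFunctorial)
    (h : ∀ a, B.traceVertices a → A.traceVertices ((f.pathMap.functor hf).obj a)) :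
    B.TraceCategory ⥤ A.TraceCategory :=
  A.traceVertices.lift (B.traceVertices.ι ⋙ f.pathMap.functor hf) (fun a => h a.obj a.property)

/-- `B` is a topological abstraction of `A`, for homology with coefficients in `R`. -/
def IsTopologicalAbstraction (R : Type w) [CommRing R] (B A : HDA.{u} M) : Prop :=
  ∃ f : WeakMorphism B A,
    f.vertexMap '' B.init = A.init ∧
    f.vertexMap '' B.final = A.final ∧
    f.vertexMap '' B.P.maximalVertices = A.P.maximalVertices ∧
    f.vertexMap '' B.P.minimalVertices = A.P.minimalVertices ∧
    (∃ e : ContinuousMap.HomotopyEquiv B.P.Realization A.P.Realization, e.toFun = f.map) ∧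
    (∃ (hf : f.pathMap.IsFunctorial)
      (h : ∀ a, B.traceVertices a → A.traceVertices ((f.pathMap.functor hf).obj a))
      (G : A.TraceCategory ⥤ B.TraceCategory),
      f.traceFunctor hf h ⋙ G = 𝟭 _ ∧ G ⋙ f.traceFunctor hf h = 𝟭 _) ∧
    IsHomologyGraphIso R f.map

end HDA

/-! Write v for the corner and Q for the complement of its star. Every cell having v as a vertex is
a face of the single regular cube x, so everything that changes between P and Q happens inside that
cube.

Topology. In the cube, coordinates are measured as distances from the facets through v. A homotopy
that fixes the facets missing v pushes the cube onto their union (`push`, `exists_push_one`).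
Extended by the identity it gives a homotopy of |P| (`exists_extended_homotopy`), so |Q| is a
deformation retract of |P|.

Homology graph. The push has a preferred direction i₀: a cell containing v ends up inside itself or
inside the cell obtained by thickening it in direction i₀. Hence it preserves the full subset on any
vertex set closed under passing from the end `k i₀` of an edge to the other end
(`exists_push_homotopy`). A pair X, Y witnessing α ↗ β in P can be enlarged to full subsets on U and
V, where U consists of the vertices that reach all of Y and V of the vertices reached from all of U.
U is closed backwards along edges and V forwards, so a direction with `k i₀ = true` serves for U and
one with `k i₀ = false` for V; this moves both classes into Q.

Fundamental category. A path through v enters along a direction i with `k i = true` and leaves along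
a direction j with `k j = false`; flipping the square of x in these directions avoids v, which gives
fullness. For faithfulness, flips in P may involve v, so the functor Hom(A, -) on the fundamental
category of Q is extended to P: its value at v is the set of compatible families of morphisms to the
ends of the edges leaving v (`HomExtension`). Edges entering v act by detours. This is consistent
because three of the facets of a 3-cube avoid a given vertex (`detour_comp`, `comp_detour`). Acting
on an identity by a path of Q returns its dihomotopy class in Q, which therefore depends only on the
class in P.

Finally, v is neither extremal nor in I ∪ F, and the other extremal vertices are the same in P and
Q, so the functor of trace categories is bijective on objects. -/

namespace PrecubicalSet

/-! ### Corners, edges and squares of a cell -/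

/-- The vertex of a cell `c` of the cube with coordinates `s` in the directions of `c`. -/
def GridCell.fill : ∀ {n m : ℕ}, GridCell n (fun _ => 1) m → (Fin m → Bool) → (Fin n → Bool)
  | _, _, .nil, _ => Fin.elim0
  | _, _, .vertex a c, s => Fin.cons (decide (a.val = 1)) (GridCell.fill c s)
  | _, _, .edge _ c, s => Fin.cons (s 0) (GridCell.fill c (Fin.tail s))

/-- For an edge entry of `c`, the face operator in the first direction is a morphism out of the
shifted precubical set, so it commutes with the rest of `c`. -/
theorem corner_sharp {n m : ℕ} (c : (cube n).cells m) (P : PrecubicalSet.{u}) (x : P.cells n)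
    (s : Fin m → Bool) : P.corner s (sharp c P x) = P.corner (GridCell.fill c s) x := by
  induction n generalizing m P with
  | zero => cases c; rfl
  | succ n ih =>
    cases c with
    | vertex a c =>
      simp only [sharp, GridCell.fill, corner, Fin.cons_zero, Fin.tail_cons]
      exact ih c P _ s
    | edge a c =>
      simp only [sharp, GridCell.fill, corner, Fin.cons_zero, Fin.tail_cons]
      have h := sharp_naturality c (shiftFace P (s 0)) x
      simp only [shiftFace] at h
      refine Eq.trans (congrArg _ h) (ih c P _ (Fin.tail s))

/-- The vertex of the cube with coordinates `s`. -/
def vertexCell : ∀ {n : ℕ}, (Fin n → Bool) → GridCell n (fun _ => 1) 0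
  | 0, _ => .nil
  | _ + 1, s => .vertex (if s 0 then (1 : Fin 2) else 0) (vertexCell (Fin.tail s))

theorem sharp_vertexCell {n : ℕ} (s : Fin n → Bool) (P : PrecubicalSet.{u}) (x : P.cells n) :
    sharp (vertexCell s : (cube n).cells 0) P x = P.corner s x := by
  induction n generalizing P with
  | zero => rfl
  | succ n ih =>
    simp only [vertexCell, sharp, corner]
    rw [← ih (Fin.tail s)]
    cases s 0 <;> rfl

theorem fill_vertexCell {n : ℕ} (s : Fin n → Bool) (t : Fin 0 → Bool) :
    GridCell.fill (vertexCell s) t = s := by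
  induction n with
  | zero => exact Subsingleton.elim _ _
  | succ n ih =>
    simp only [vertexCell, GridCell.fill]
    erw [ih (Fin.tail s)]
    conv_rhs => rw [← Fin.cons_self_tail s]
    congr 1
    cases s 0 <;> rfl

theorem vertexCell_injective {n : ℕ} :
    Function.Injective (vertexCell : (Fin n → Bool) → _) := fun s t h => by
  rw [← fill_vertexCell s Fin.elim0, h, fill_vertexCell]

/-- The form in which regularity enters the combinatorial arguments: vertices of x can be told apart
by their coordinates. -/
theorem IsRegular.corner_injective {P : PrecubicalSet.{u}} {n : ℕ} {x : P.cells n}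
    (hx : P.IsRegular x) : Function.Injective (fun s : Fin n → Bool => P.corner s x) := by
  intro s t h
  refine vertexCell_injective (hx 0 ?_)
  simpa [sharpHom, sharp_vertexCell] using h

theorem exists_vertexCell {n : ℕ} (c : (cube n).cells 0) : ∃ s, c = vertexCell s := by
  induction n with
  | zero => cases c; exact ⟨Fin.elim0, rfl⟩
  | succ n ih =>
    cases c with
    | vertex a c =>
      obtain ⟨s, rfl⟩ := ih c
      refine ⟨Fin.cons (decide (a = 1)) s, ?_⟩
      simp only [vertexCell, Fin.cons_zero, Fin.tail_cons]
      congr 1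
      change Fin 2 at a
      fin_cases a <;> rfl

theorem mem_cubeImage_zero {P : PrecubicalSet.{u}} {n : ℕ} {y : P.cells n} {a : P.cells 0} :
    a ∈ P.cubeImage y 0 ↔ ∃ s, P.corner s y = a := by
  constructor
  · rintro ⟨c, rfl⟩
    obtain ⟨s, rfl⟩ := exists_vertexCell c
    exact ⟨s, (sharp_vertexCell s P y).symm⟩
  · rintro ⟨s, rfl⟩
    exact ⟨vertexCell s, sharp_vertexCell s P y⟩

theorem mem_star {P : PrecubicalSet.{u}} {n : ℕ} {y : P.cells n} {a : P.cells 0} :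
    y ∈ P.star a n ↔ ∃ s, P.corner s y = a := mem_cubeImage_zero

theorem corner_succ {P : PrecubicalSet.{u}} {n : ℕ} (s : Fin (n + 1) → Bool)
    (y : P.cells (n + 1)) : P.corner s y = P.corner (Fin.tail s) (P.face (s 0) 0 y) := rfl

/-- Removing a coordinate of a corner. -/
theorem corner_insertNth {P : PrecubicalSet.{u}} {m : ℕ} (j : Fin (m + 1)) (ε : Bool)
    (s : Fin m → Bool) (y : P.cells (m + 1)) :
    P.corner (j.insertNth (α := fun _ => Bool) ε s) y = P.corner s (P.face ε j y) := by
  induction m with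
  | zero =>
    have hj : j = 0 := Subsingleton.elim (α := Fin 1) _ _
    subst hj
    simp [corner]
  | succ m ih =>
    induction j using Fin.cases with
    | zero => simp [corner]
    | succ j =>
      obtain ⟨s₀, s, rfl⟩ : ∃ a t, s = Fin.cons a t := ⟨s 0, Fin.tail s, (Fin.cons_self_tail s).symm⟩
      rw [Fin.insertNth_succ_cons]
      change P.corner (j.insertNth (α := fun _ => Bool) ε s) (P.face s₀ 0 y) =
        P.corner s (P.face s₀ 0 (P.face ε j.succ y))
      rw [ih, P.face_face _ ε 0 j (Fin.zero_le _) y]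
      rfl

/-- The edge of `y` in direction `j` between corners that agree with `s` outside coordinate `j`. -/
def edgeAt : ∀ {n : ℕ} (P : PrecubicalSet.{u}) (_ : Fin n → Bool) (_ : Fin n) (_ : P.cells n),
    P.cells 1
  | 0, _, _, j, _ => j.elim0
  | _ + 1, P, s, j, y =>
      Fin.cases (P.shift.corner (Fin.tail s) y)
        (fun j' => P.edgeAt (Fin.tail s) j' (P.face (s 0) 0 y)) j

theorem edgeAt_zero {n : ℕ} (P : PrecubicalSet.{u}) (s : Fin (n + 1) → Bool)
    (y : P.cells (n + 1)) : P.edgeAt s 0 y = P.shift.corner (Fin.tail s) y := rfl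

theorem edgeAt_succ {n : ℕ} (P : PrecubicalSet.{u}) (s : Fin (n + 1) → Bool) (j : Fin n)
    (y : P.cells (n + 1)) :
    P.edgeAt s j.succ y = P.edgeAt (Fin.tail s) j (P.face (s 0) 0 y) := rfl

theorem app_corner {P Q : PrecubicalSet.{u}} (f : Hom P Q) {n : ℕ} (s : Fin n → Bool)
    (y : P.cells n) : f.app (P.corner s y) = Q.corner s (f.app y) := by
  induction n with
  | zero => rfl
  | succ n ih => simp only [corner]; rw [ih, f.app_face]

theorem app_edgeAt {P Q : PrecubicalSet.{u}} (f : Hom P Q) {n : ℕ} (s : Fin n → Bool) (j : Fin n)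
    (y : P.cells n) : f.app (P.edgeAt s j y) = Q.edgeAt s j (f.app y) := by
  induction n generalizing P Q with
  | zero => exact j.elim0
  | succ n ih =>
    induction j using Fin.cases with
    | zero =>
      exact app_corner (P := P.shift) (Q := Q.shift)
        ⟨fun y => f.app y, fun ε i y => f.app_face ε i.succ y⟩ (Fin.tail s) y
    | succ j => rw [edgeAt_succ, edgeAt_succ, ih, f.app_face]

theorem tail_update_succ {n : ℕ} (s : Fin (n + 1) → Bool) (j : Fin n) (ε : Bool) :
    Fin.tail (Function.update s j.succ ε) = Function.update (Fin.tail s) j ε := by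
  exact Fin.tail_update_succ s j ε

theorem face_edgeAt {n : ℕ} (P : PrecubicalSet.{u}) (s : Fin n → Bool) (j : Fin n)
    (y : P.cells n) (ε : Bool) :
    P.face ε 0 (P.edgeAt s j y) = P.corner (Function.update s j ε) y := by
  induction n generalizing P with
  | zero => exact j.elim0
  | succ n ih =>
    induction j using Fin.cases with
    | zero =>
      rw [edgeAt_zero]
      have := app_corner (shiftFace P ε) (Fin.tail s) y
      simpa [shiftFace, corner] using this
    | succ j =>
      rw [edgeAt_succ, ih]
      simp [corner, (Fin.succ_ne_zero j).symm]

theorem edgeAt_update {n : ℕ} (P : PrecubicalSet.{u}) (s : Fin n → Bool) (j : Fin n)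
    (y : P.cells n) (ε : Bool) :
    P.edgeAt (Function.update s j ε) j y = P.edgeAt s j y := by
  induction n generalizing P with
  | zero => exact j.elim0
  | succ n ih =>
    induction j using Fin.cases with
    | zero => rw [edgeAt_zero, edgeAt_zero, Fin.tail_update_zero]
    | succ j =>
      rw [edgeAt_succ, edgeAt_succ, tail_update_succ, ih]
      simp [(Fin.succ_ne_zero j).symm]

/-- The direction is chosen before `P` and `x`, so that `exists_isSquareAt_of_sharp` can use it for
the shifted precubical set. -/
theorem exists_edgeAt_of_sharp {n : ℕ} (c : (cube n).cells 1) (s' : Fin 1 → Bool) :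
    ∃ i, ∀ (P : PrecubicalSet.{u}) (x : P.cells n), sharp c P x = P.edgeAt (GridCell.fill c s') i x := by
  induction n with
  | zero => cases c
  | succ n ih =>
    cases c with
    | vertex a c =>
      obtain ⟨i, hi⟩ := ih c
      refine ⟨i.succ, fun P x => ?_⟩
      simp only [sharp, GridCell.fill, edgeAt_succ, Fin.cons_zero, Fin.tail_cons]
      exact hi P _
    | edge a c =>
      obtain ⟨t, rfl⟩ := exists_vertexCell c
      refine ⟨0, fun P x => ?_⟩
      simp only [sharp, GridCell.fill, edgeAt_zero, Fin.tail_cons]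
      rw [sharp_vertexCell t P.shift x]
      erw [fill_vertexCell t]

/-- `z` is the square of `y` in the directions `i` and `j` through the corner `s`. -/
def IsSquareAt (P : PrecubicalSet.{u}) {n : ℕ} (y : P.cells n) (s : Fin n → Bool) (i j : Fin n)
    (z : P.cells 2) : Prop :=
  ∀ ε, P.face ε 0 z = P.edgeAt (Function.update s i ε) j y ∧
    P.face ε 1 z = P.edgeAt (Function.update s j ε) i y

theorem isSquareAt_edgeAt_shift (P : PrecubicalSet.{u}) {n : ℕ} (x : P.cells (n + 1))
    (s : Fin (n + 1) → Bool) (j : Fin n) :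
    P.IsSquareAt x s 0 j.succ (P.shift.edgeAt (Fin.tail s) j x) := by
  intro ε
  constructor
  · have := app_edgeAt (shiftFace P ε) (Fin.tail s) j x
    simpa [shiftFace, edgeAt_succ] using this
  · rw [edgeAt_zero, tail_update_succ]
    exact face_edgeAt P.shift (Fin.tail s) j x ε

theorem IsSquareAt.succ {P : PrecubicalSet.{u}} {n : ℕ} {x : P.cells (n + 1)}
    {s : Fin (n + 1) → Bool} {i j : Fin n} {z : P.cells 2}
    (h : P.IsSquareAt (P.face (s 0) 0 x) (Fin.tail s) i j z) :
    P.IsSquareAt x s i.succ j.succ z := by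
  intro ε
  rw [edgeAt_succ, edgeAt_succ, tail_update_succ, tail_update_succ,
    Function.update_of_ne (Fin.succ_ne_zero i).symm, Function.update_of_ne (Fin.succ_ne_zero j).symm]
  exact h ε

theorem exists_isSquareAt (P : PrecubicalSet.{u}) {n : ℕ} (y : P.cells n) (s : Fin n → Bool)
    {i j : Fin n} (hij : i < j) : ∃ z, P.IsSquareAt y s i j z := by
  induction n generalizing P with
  | zero => exact i.elim0
  | succ n ih =>
    induction j using Fin.cases with
    | zero => simp at hij
    | succ j =>
      induction i using Fin.cases with
      | zero => exact ⟨_, P.isSquareAt_edgeAt_shift y s j⟩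
      | succ i =>
        obtain ⟨z, hz⟩ := ih P (P.face (s 0) 0 y) (Fin.tail s) (by simpa using hij)
        exact ⟨z, hz.succ⟩

theorem exists_isSquareAt_of_sharp {n : ℕ} (c : (cube n).cells 2) (s' : Fin 2 → Bool) :
    ∃ i j, i < j ∧ ∀ (P : PrecubicalSet.{u}) (x : P.cells n),
      P.IsSquareAt x (GridCell.fill c s') i j (sharp c P x) := by
  induction n with
  | zero => cases c
  | succ n ih =>
    cases c with
    | vertex a c =>
      obtain ⟨i, j, hij, h⟩ := ih c
      refine ⟨i.succ, j.succ, by simpa using hij, fun P x => ?_⟩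
      apply IsSquareAt.succ
      simp only [sharp, GridCell.fill, Fin.cons_zero, Fin.tail_cons]
      exact h P _
    | edge a c =>
      obtain ⟨j, hj⟩ := exists_edgeAt_of_sharp.{u} c (Fin.tail s')
      refine ⟨0, j.succ, Fin.succ_pos j, fun P x => ?_⟩
      have h := P.isSquareAt_edgeAt_shift x (GridCell.fill (GridCell.edge a c) s') j
      simp only [GridCell.fill, Fin.tail_cons] at h ⊢
      have e : sharp (GridCell.edge a c : (cube (n + 1)).cells 2) P x
        = P.shift.edgeAt (GridCell.fill c (Fin.tail s')) j x := hj P.shift x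
      rw [e]
      exact h

/-! ### Full subsets and complements of stars -/

/-- The set of all cells all of whose vertices belong to `U`. -/
def fullSubset (P : PrecubicalSet.{u}) (U : Set (P.cells 0)) : P.Subset where
  carrier n := {y | ∀ s, P.corner s y ∈ U}
  face_mem ε i y hy s := by
    rw [← corner_insertNth]
    exact hy _

theorem Subset.corner_mem {P : PrecubicalSet.{u}} (X : P.Subset) {n : ℕ} {y : P.cells n}
    (hy : y ∈ X.carrier n) (s : Fin n → Bool) : P.corner s y ∈ X.carrier 0 := by
  induction n with
  | zero => exact hy
  | succ n ih => exact ih (X.face_mem _ _ hy) _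

theorem mem_starComplement {P : PrecubicalSet.{u}} {a : P.cells 0} {n : ℕ} {y : P.cells n} :
    y ∈ (P.starComplement a).carrier n ↔ ∀ s, P.corner s y ≠ a := by
  change ¬ (y ∈ P.star a n) ↔ _
  rw [mem_star]
  push Not
  rfl

/-- If `U` is closed under passing from the end `ε` of an edge to the other end, then a cell
belongs to the full subset as soon as one of its `ε`-faces does. -/
theorem mem_fullSubset_of_face {P : PrecubicalSet.{u}} {U : Set (P.cells 0)} {ε : Bool}
    (hU : ∀ e : P.cells 1, P.face ε 0 e ∈ U → P.face (!ε) 0 e ∈ U) {n : ℕ} {y : P.cells (n + 1)}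
    {j : Fin (n + 1)} (h : P.face ε j y ∈ (P.fullSubset U).carrier n) :
    y ∈ (P.fullSubset U).carrier (n + 1) := by
  have key : ∀ s, P.corner (Function.update s j ε) y ∈ U := fun s => by
    have := h (j.removeNth s)
    rwa [← corner_insertNth, Fin.insertNth_removeNth] at this
  intro s
  by_cases hs : s j = ε
  · rw [← Function.update_eq_self j s, hs]
    exact key s
  · have h1 : s j = !ε := by cases ε <;> simp_all
    rw [← Function.update_eq_self j s, h1, ← face_edgeAt]
    refine hU _ ?_
    rw [face_edgeAt]
    exact key s

/-! ### Normal forms of points of the realization -/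

theorem unitEnd_injective : Function.Injective unitEnd := by
  intro a b h
  cases a <;> cases b <;> simp_all [unitEnd]

/-- The point with coordinates `t` in the cell `y`, written with coordinates in the open cube of the
unique cell that contains it in its interior. -/
noncomputable def normalForm (P : PrecubicalSet.{u}) :
    ∀ {n : ℕ}, P.cells n → (Fin n → unitInterval) → P.PreRealization
  | 0, y, t => ⟨⟨0, y⟩, t⟩
  | n + 1, y, t => open Classical in
      if h : ∃ p : Fin (n + 1) × Bool, t p.1 = unitEnd p.2 then
        P.normalForm (P.face h.choose.2 h.choose.1 y) (h.choose.1.removeNth t)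
      else ⟨⟨n + 1, y⟩, t⟩

theorem normalForm_of_interior (P : PrecubicalSet.{u}) {n : ℕ} (y : P.cells n)
    (t : Fin n → unitInterval) (h : ¬ ∃ p : Fin n × Bool, t p.1 = unitEnd p.2) :
    P.normalForm y t = ⟨⟨n, y⟩, t⟩ := by
  cases n with
  | zero => rfl
  | succ n => rw [normalForm, dif_neg h]

theorem succAbove_succAbove_comm {m : ℕ} {i j : Fin (m + 1)} (hij : i ≤ j) (a : Fin m) :
    j.succ.succAbove (i.succAbove a) = i.castSucc.succAbove (j.succAbove a) := by
  ext
  simp only [Fin.succAbove, Fin.lt_def, Fin.le_def] at *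
  grind [Fin.val_castSucc]

/-- The chosen facet is irrelevant: if the point lies on two different facets, it lies on their
intersection, which by the precubical identity is the same face of either one, and the induction
hypothesis applies to both facets. Equal positions force equal ends. -/
theorem normalForm_face (P : PrecubicalSet.{u}) {n : ℕ} (y : P.cells (n + 1))
    (t : Fin (n + 1) → unitInterval) (i : Fin (n + 1)) (ε : Bool) (h : t i = unitEnd ε) :
    P.normalForm y t = P.normalForm (P.face ε i y) (i.removeNth t) := by
  induction n generalizing ε with
  | zero =>
    have hex : ∃ p : Fin 1 × Bool, t p.1 = unitEnd p.2 := ⟨(i, ε), h⟩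
    rw [normalForm.eq_2, dif_pos hex]
    have h1 : hex.choose.1 = i := Subsingleton.elim (α := Fin 1) _ _
    have h2 : hex.choose.2 = ε := unitEnd_injective (by rw [← hex.choose_spec, h1, h])
    rw [h1, h2]
  | succ m ih =>
    have swap : ∀ (i j : Fin (m + 1)) (ε δ : Bool), i ≤ j → t j.succ = unitEnd δ →
        t i.castSucc = unitEnd ε →
        P.normalForm (P.face δ j.succ y) (j.succ.removeNth t) =
          P.normalForm (P.face ε i.castSucc y) (i.castSucc.removeNth t) := by
      intro i j ε δ hij hj hi
      have hi' : (j.succ.removeNth t) i = unitEnd ε := by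
        rw [Fin.removeNth_apply, Fin.succAbove_of_castSucc_lt _ _ (by simpa using hij), hi]
      have hj' : (i.castSucc.removeNth t) j = unitEnd δ := by
        rw [Fin.removeNth_apply, Fin.succAbove_of_le_castSucc _ _ (by simpa using hij), hj]
      rw [ih _ _ _ _ hi', ih _ _ _ _ hj', P.face_face ε δ i j hij y]
      congr 1
      funext a
      simp only [Fin.removeNth_apply, succAbove_succAbove_comm hij]
    have hex : ∃ p : Fin (m + 2) × Bool, t p.1 = unitEnd p.2 := ⟨(i, ε), h⟩
    rw [normalForm, dif_pos hex]
    generalize hp : hex.choose = p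
    have hspec : t p.1 = unitEnd p.2 := hp ▸ hex.choose_spec
    obtain ⟨i₀, ε₀⟩ := p
    simp only at hspec ⊢
    rcases lt_trichotomy i₀ i with hlt | heq | hlt
    · obtain ⟨j, rfl⟩ := Fin.exists_succ_eq.2 (Fin.ne_zero_of_lt hlt)
      obtain ⟨k, rfl⟩ := Fin.exists_castSucc_eq.2 (ne_of_lt (lt_of_lt_of_le hlt (Fin.le_last _)))
      exact (swap k j _ _ (Fin.castSucc_lt_succ_iff.1 hlt) h hspec).symm
    · subst heq
      rw [unitEnd_injective (hspec.symm.trans h)]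
    · obtain ⟨j, rfl⟩ := Fin.exists_succ_eq.2 (Fin.ne_zero_of_lt hlt)
      obtain ⟨k, rfl⟩ := Fin.exists_castSucc_eq.2 (ne_of_lt (lt_of_lt_of_le hlt (Fin.le_last _)))
      exact swap k j _ _ (Fin.castSucc_lt_succ_iff.1 hlt) hspec h

theorem point_face (P : PrecubicalSet.{u}) {n : ℕ} (x : P.cells (n + 1)) (ε : Bool)
    (i : Fin (n + 1)) (t : Fin n → unitInterval) :
    P.point (P.face ε i x) t =
      P.point x (i.insertNth (α := fun _ => unitInterval) (unitEnd ε) t) :=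
  Quot.sound (RealizationRel.glue x ε i t)

theorem point_eq_face (P : PrecubicalSet.{u}) {n : ℕ} (x : P.cells (n + 1))
    (t : Fin (n + 1) → unitInterval) {ε : Bool} {i : Fin (n + 1)} (h : t i = unitEnd ε) :
    P.point x t = P.point (P.face ε i x) (i.removeNth t) := by
  rw [point_face, ← h, Fin.insertNth_self_removeNth]

theorem exists_point (P : PrecubicalSet.{u}) (p : P.Realization) :
    ∃ (n : ℕ) (y : P.cells n) (t : Fin n → unitInterval), P.point y t = p := by
  obtain ⟨⟨⟨n, y⟩, t⟩, rfl⟩ := Quot.exists_rep p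
  exact ⟨n, y, t, rfl⟩

/-- The normal form of a point of the geometric realization. -/
noncomputable def pointForm (P : PrecubicalSet.{u}) : P.Realization → P.PreRealization :=
  Quot.lift (fun p => P.normalForm p.1.2 p.2) (by
    rintro _ _ ⟨x, ε, i, t⟩
    have := P.normalForm_face x (i.insertNth (α := fun _ => unitInterval) (unitEnd ε) t) i ε
      (by simp)
    simpa using this.symm)

theorem pointForm_point (P : PrecubicalSet.{u}) {n : ℕ} (y : P.cells n)
    (t : Fin n → unitInterval) : P.pointForm (P.point y t) = P.normalForm y t := rfl

theorem point_normalForm (P : PrecubicalSet.{u}) {n : ℕ} (y : P.cells n)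
    (t : Fin n → unitInterval) :
    P.point (P.normalForm y t).1.2 (P.normalForm y t).2 = P.point y t := by
  induction n with
  | zero => rfl
  | succ n ih =>
    by_cases h : ∃ p : Fin (n + 1) × Bool, t p.1 = unitEnd p.2
    · obtain ⟨⟨i, ε⟩, h⟩ := h
      rw [P.normalForm_face y t i ε h, ih, P.point_eq_face y t h]
    · rw [P.normalForm_of_interior y t h]

theorem point_pointForm (P : PrecubicalSet.{u}) (p : P.Realization) :
    P.point (P.pointForm p).1.2 (P.pointForm p).2 = p := by
  obtain ⟨n, y, t, rfl⟩ := P.exists_point p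
  exact P.point_normalForm y t

theorem Hom.normalForm_app {P Q : PrecubicalSet.{u}} (f : Hom P Q) {n : ℕ} (y : P.cells n)
    (t : Fin n → unitInterval) :
    Q.normalForm (f.app y) t = ⟨⟨_, f.app (P.normalForm y t).1.2⟩, (P.normalForm y t).2⟩ := by
  induction n with
  | zero => rfl
  | succ n ih =>
    by_cases h : ∃ p : Fin (n + 1) × Bool, t p.1 = unitEnd p.2
    · obtain ⟨⟨i, ε⟩, h⟩ := h
      rw [P.normalForm_face y t i ε h, Q.normalForm_face (f.app y) t i ε h, ← f.app_face, ih]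
    · rw [P.normalForm_of_interior y t h, Q.normalForm_of_interior _ t h]

theorem Hom.pointForm_realization {P Q : PrecubicalSet.{u}} (f : Hom P Q) (p : P.Realization) :
    Q.pointForm (f.realization p) = ⟨⟨_, f.app (P.pointForm p).1.2⟩, (P.pointForm p).2⟩ := by
  obtain ⟨n, y, t, rfl⟩ := P.exists_point p
  exact f.normalForm_app y t

/-- A morphism changes the cell of a normal form and keeps its coordinates, and a point is recovered
from its normal form. -/
theorem Hom.realization_injective {P Q : PrecubicalSet.{u}} (f : Hom P Q)
    (hf : ∀ n, Function.Injective (fun y : P.cells n => f.app y)) :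
    Function.Injective f.realization := by
  intro p q h
  have h1 := f.pointForm_realization p
  rw [h, f.pointForm_realization q] at h1
  rw [← P.point_pointForm p, ← P.point_pointForm q]
  generalize P.pointForm p = a at *
  generalize P.pointForm q = b at *
  obtain ⟨⟨n, y⟩, t⟩ := a
  obtain ⟨⟨m, z⟩, s⟩ := b
  simp only [Sigma.mk.injEq] at h1
  obtain ⟨⟨rfl, h1⟩, h2⟩ := h1
  simp only [heq_eq_eq] at h1 h2
  rw [hf _ h1, h2]

/-! ### Precubical subsets as closed subspaces -/

theorem Subset.incl_injective {P : PrecubicalSet.{u}} (X : P.Subset) (n : ℕ) :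
    Function.Injective (fun y : X.toPrecubicalSet.cells n => X.incl.app y) :=
  Subtype.val_injective

theorem Subset.mem_range_incl {P : PrecubicalSet.{u}} (X : P.Subset) (p : P.Realization) :
    p ∈ Set.range X.incl.realization ↔ (P.pointForm p).1.2 ∈ X.carrier (P.pointForm p).1.1 := by
  constructor
  · rintro ⟨q, rfl⟩
    rw [X.incl.pointForm_realization]
    exact (X.toPrecubicalSet.pointForm q).1.2.2
  · intro h
    exact ⟨X.toPrecubicalSet.point ⟨_, h⟩ (P.pointForm p).2, P.point_pointForm p⟩

theorem Subset.point_mem_range {P : PrecubicalSet.{u}} (X : P.Subset) {n : ℕ} {y : P.cells n}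
    (hy : y ∈ X.carrier n) (t : Fin n → unitInterval) :
    P.point y t ∈ Set.range X.incl.realization :=
  ⟨X.toPrecubicalSet.point ⟨y, hy⟩ t, rfl⟩

theorem continuous_point (P : PrecubicalSet.{u}) {n : ℕ} (y : P.cells n) :
    Continuous (P.point y) :=
  continuous_quot_mk.comp
    (continuous_sigmaMk (σ := fun c : (Σ n : ℕ, P.cells n) => (Fin c.1 → unitInterval))
      (i := ⟨n, y⟩))

theorem isClosed_realization_iff (P : PrecubicalSet.{u}) (C : Set P.Realization) :
    IsClosed C ↔ ∀ (n : ℕ) (y : P.cells n), IsClosed (P.point y ⁻¹' C) := by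
  constructor
  · exact fun h n y => h.preimage (P.continuous_point y)
  · intro h
    refine (isQuotientMap_quot_mk (r := P.RealizationRel)).isClosed_preimage.1 ?_
    rw [isClosed_sigma_iff]
    rintro ⟨n, y⟩
    exact h n y

/-- The realization of a precubical subset is a closed subspace. -/
theorem Subset.isClosedEmbedding_incl {P : PrecubicalSet.{u}} (X : P.Subset) :
    Topology.IsClosedEmbedding X.incl.realization := by
  have hinj := X.incl.realization_injective X.incl_injective
  refine .of_continuous_injective_isClosedMap X.incl.realization.continuous hinj ?_
  intro C hC
  rw [isClosed_realization_iff]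
  intro n
  induction n with
  | zero =>
    intro y
    by_cases hy : y ∈ X.carrier 0
    · convert hC.preimage (X.toPrecubicalSet.continuous_point ⟨y, hy⟩) using 1
      exact Set.ext fun t => hinj.mem_set_image (a := X.toPrecubicalSet.point ⟨y, hy⟩ t)
    · convert isClosed_empty
      refine Set.eq_empty_iff_forall_notMem.2 fun t ht => hy ?_
      exact (X.mem_range_incl _).1 (Set.image_subset_range _ _ ht)
  | succ n ih =>
    intro y
    by_cases hy : y ∈ X.carrier (n + 1)
    · convert hC.preimage (X.toPrecubicalSet.continuous_point ⟨y, hy⟩) using 1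
      exact Set.ext fun t => hinj.mem_set_image (a := X.toPrecubicalSet.point ⟨y, hy⟩ t)
    -- A point in the interior of a cell outside X is not in |X|. The preimage in such a cell is
    -- therefore the union of its traces on the finitely many facets, each closed by induction and
    -- hence compact.
    · have heq : P.point y ⁻¹' (X.incl.realization '' C) = ⋃ p : Fin (n + 1) × Bool,
          (fun t => p.1.insertNth (α := fun _ => unitInterval) (unitEnd p.2) t) ''
            (P.point (P.face p.2 p.1 y) ⁻¹' (X.incl.realization '' C)) := by
        ext t
        simp only [Set.mem_iUnion]
        constructor
        · intro ht
          by_cases h : ∃ p : Fin (n + 1) × Bool, t p.1 = unitEnd p.2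
          · obtain ⟨p, hp⟩ := h
            refine ⟨p, p.1.removeNth t, ?_, ?_⟩
            · rw [Set.mem_preimage, ← P.point_eq_face y t hp]
              exact ht
            · simp only [← hp, Fin.insertNth_self_removeNth]
          · have := (X.mem_range_incl _).1 (Set.image_subset_range _ _ ht)
            rw [pointForm_point, P.normalForm_of_interior y t h] at this
            exact absurd this hy
        · rintro ⟨p, s, hs, rfl⟩
          rw [Set.mem_preimage, P.point_face] at hs
          exact hs
      rw [heq]
      refine isClosed_iUnion_of_finite fun p => ?_
      refine (((ih _).isCompact).image ?_).isClosed
      exact (continuous_const.finInsertNth p.1 continuous_id)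

/-! ### Faces of the cube in coordinates -/

/-- The coordinates in the cube of a point with coordinates `t` in the cell `c`. -/
def cellCoord : ∀ {n m : ℕ}, GridCell n (fun _ => 1) m → (Fin m → unitInterval) →
    (Fin n → unitInterval)
  | _, _, .nil, _ => Fin.elim0
  | _, _, .vertex a c, t => Fin.cons (unitEnd (decide (a.val = 1))) (cellCoord c t)
  | _, _, .edge _ c, t => Fin.cons (t 0) (cellCoord c (Fin.tail t))

/-- Adding a first coordinate to the points of the realization of the shifted precubical set. -/
def shiftPoint (P : PrecubicalSet.{u}) (a : unitInterval) : P.shift.Realization → P.Realization :=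
  Quot.lift (fun p => P.point (n := p.1.1 + 1) p.1.2
      (Fin.cons (α := fun _ => unitInterval) a p.2)) (by
    rintro _ _ ⟨x, ε, i, t⟩
    have := P.point_face (x : P.cells _) ε i.succ (Fin.cons (α := fun _ => unitInterval) a t)
    rw [Fin.insertNth_succ_cons] at this
    exact this)

/-- A vertex entry is one gluing relation. For an edge entry, the identity in the shifted precubical
set is transported by `shiftPoint`. -/
theorem point_sharp {n m : ℕ} (c : (cube n).cells m) (P : PrecubicalSet.{u}) (x : P.cells n)
    (t : Fin m → unitInterval) : P.point (sharp c P x) t = P.point x (cellCoord c t) := by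
  induction n generalizing m P with
  | zero =>
    cases c
    exact congrArg _ (Subsingleton.elim _ _)
  | succ n ih =>
    cases c with
    | vertex a c =>
      simp only [sharp, cellCoord]
      refine (ih c P _ t).trans ?_
      rw [P.point_face, Fin.insertNth_zero]
      rfl
    | edge a c =>
      simp only [sharp, cellCoord]
      have := congrArg (P.shiftPoint (t 0)) (ih c P.shift x (Fin.tail t))
      simp only [shiftPoint, point] at this
      rwa [Fin.cons_self_tail] at this

theorem continuous_cellCoord {n m : ℕ} (c : (cube n).cells m) :
    Continuous (fun t : Fin m → unitInterval => cellCoord c t) := by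
  induction n generalizing m with
  | zero => exact continuous_of_const fun _ _ => Subsingleton.elim _ _
  | succ n ih =>
    cases c with
    | vertex a c => exact continuous_const.finCons (ih c)
    | edge a c =>
      have h : Continuous fun t : Fin _ → unitInterval => cellCoord c (Fin.tail t) :=
        (ih c).comp (continuous_pi fun i => continuous_apply i.succ)
      refine continuous_pi fun i => ?_
      induction i using Fin.cases with
      | zero => exact continuous_apply 0
      | succ i => exact (continuous_apply i).comp h

/-- The coordinates of a point of a face are those of its image in the cell. -/
theorem cellCoord_face {n m : ℕ} (c : (cube n).cells (m + 1)) (ε : Bool) (i : Fin (m + 1))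
    (t : Fin m → unitInterval) :
    cellCoord ((cube n).face ε i c) t =
      cellCoord c (i.insertNth (α := fun _ => unitInterval) (unitEnd ε) t) := by
  change cellCoord (GridCell.face ε i c) t = _
  induction n generalizing m with
  | zero => cases c
  | succ n ih =>
    cases c with
    | vertex a c => rw [GridCell.face_vertex]; exact congrArg _ (ih c _ _)
    | edge a c =>
      induction i using Fin.cases with
      | zero =>
        rw [GridCell.face_edge_zero]
        have ha : a = 0 := Subsingleton.elim (α := Fin 1) _ _
        subst ha
        simp only [cellCoord, Fin.insertNth_zero, Fin.cons_zero, Fin.tail_cons]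
        cases ε <;> rfl
      | succ i =>
        cases m with
        | zero => exact i.elim0
        | succ m =>
          rw [GridCell.face_edge_succ]
          obtain ⟨t₀, t, rfl⟩ : ∃ a s, t = Fin.cons (α := fun _ => unitInterval) a s :=
            ⟨t 0, Fin.tail t, (Fin.cons_self_tail t).symm⟩
          rw [Fin.insertNth_succ_cons]
          simp only [cellCoord, Fin.cons_zero, Fin.tail_cons]
          exact congrArg _ (ih c _ _)

/-! ### Pushing the cube away from a corner -/

/-- The reflection of the unit interval that moves the end `ε` to `0`. -/
def reflect (ε : Bool) (a : unitInterval) : unitInterval := if ε then unitInterval.symm a else a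

theorem continuous_reflect (ε : Bool) : Continuous (reflect ε) := by
  cases ε
  · exact continuous_id
  · exact unitInterval.continuous_symm

theorem reflect_reflect (ε : Bool) (a : unitInterval) : reflect ε (reflect ε a) = a := by
  cases ε <;> simp [reflect]

theorem reflect_unitEnd (ε : Bool) : reflect ε (unitEnd ε) = 0 := by
  cases ε <;> simp [reflect, unitEnd]

theorem reflect_unitEnd_not (ε : Bool) : reflect ε (unitEnd (!ε)) = 1 := by
  cases ε <;> simp [reflect, unitEnd]

theorem reflect_zero (ε : Bool) : reflect ε 0 = unitEnd ε := by
  cases ε <;> simp [reflect, unitEnd]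

theorem reflect_one (ε : Bool) : reflect ε 1 = unitEnd (!ε) := by
  cases ε <;> simp [reflect, unitEnd]

/-- The distances of a point of the cube from the facets through the corner `k`. -/
def cornerDist {n : ℕ} (k : Fin n → Bool) (t : Fin n → unitInterval) : Fin n → ℝ :=
  fun i => reflect (k i) (t i)

theorem continuous_cornerDist {n : ℕ} (k : Fin n → Bool) : Continuous (cornerDist k) :=
  continuous_pi fun i => continuous_subtype_val.comp
    ((continuous_reflect (k i)).comp (continuous_apply i))

theorem cornerDist_nonneg {n : ℕ} (k : Fin n → Bool) (t : Fin n → unitInterval) (i : Fin n) :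
    0 ≤ cornerDist k t i := (reflect (k i) (t i)).2.1

theorem cornerDist_le_one {n : ℕ} (k : Fin n → Bool) (t : Fin n → unitInterval) (i : Fin n) :
    cornerDist k t i ≤ 1 := (reflect (k i) (t i)).2.2

theorem cornerDist_le_norm {n : ℕ} (k : Fin n → Bool) (t : Fin n → unitInterval) (i : Fin n) :
    cornerDist k t i ≤ ‖cornerDist k t‖ :=
  (le_abs_self _).trans (norm_le_pi_norm (cornerDist k t) i)

theorem norm_cornerDist_le_one {n : ℕ} (k : Fin n → Bool) (t : Fin n → unitInterval) :
    ‖cornerDist k t‖ ≤ 1 :=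
  (pi_norm_le_iff_of_nonneg zero_le_one).2 fun i => by
    rw [Real.norm_of_nonneg (cornerDist_nonneg k t i)]
    exact cornerDist_le_one k t i

/-- A homotopy that pushes the cube away from the corner `k`, in the direction `i₀`, onto the union
of the facets that do not contain the corner. -/
noncomputable def push {n : ℕ} (k : Fin n → Bool) (i₀ : Fin n)
    (p : unitInterval × (Fin n → unitInterval)) : Fin n → unitInterval := fun i =>
  reflect (k i) (Set.projIcc (0 : ℝ) 1 zero_le_one
    -- The factor `1 - ‖cornerDist‖` vanishes on the facets that miss the corner, so they stay
    -- fixed. Direction `i₀` is translated, which moves even the corner itself. The other directions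
    -- are only rescaled, so that a zero distance stays zero. The projection truncates at distance
    -- 1.
    (if i = i₀ then cornerDist k p.2 i + 2 * p.1 * (1 - ‖cornerDist k p.2‖)
      else cornerDist k p.2 i * (1 + 2 * p.1 * (1 - ‖cornerDist k p.2‖))))

theorem continuous_push {n : ℕ} (k : Fin n → Bool) (i₀ : Fin n) : Continuous (push k i₀) := by
  have hc := continuous_cornerDist k
  refine continuous_pi fun i => (continuous_reflect (k i)).comp (continuous_projIcc.comp ?_)
  have h1 : Continuous fun p : unitInterval × (Fin n → unitInterval) => cornerDist k p.2 i :=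
    (continuous_apply i).comp (hc.comp continuous_snd)
  have h2 : Continuous fun p : unitInterval × (Fin n → unitInterval) => ‖cornerDist k p.2‖ :=
    (hc.comp continuous_snd).norm
  split_ifs <;> fun_prop

theorem reflect_projIcc_cornerDist {n : ℕ} (k : Fin n → Bool) (t : Fin n → unitInterval)
    (i : Fin n) :
    reflect (k i) (Set.projIcc (0 : ℝ) 1 zero_le_one (cornerDist k t i)) = t i := by
  unfold cornerDist
  rw [Set.projIcc_val, reflect_reflect]

theorem push_zero {n : ℕ} (k : Fin n → Bool) (i₀ : Fin n) (t : Fin n → unitInterval) :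
    push k i₀ (0, t) = t := by
  funext i
  simp [push, reflect_projIcc_cornerDist]

theorem push_of_facet {n : ℕ} (k : Fin n → Bool) (i₀ : Fin n) (s : unitInterval)
    (t : Fin n → unitInterval) (h : ∃ i, t i = unitEnd (!k i)) : push k i₀ (s, t) = t := by
  obtain ⟨j, hj⟩ := h
  have h1 : ‖cornerDist k t‖ = 1 := by
    refine le_antisymm (norm_cornerDist_le_one k t) ?_
    refine le_trans ?_ (cornerDist_le_norm k t j)
    simp [cornerDist, hj, reflect_unitEnd_not]
  funext i
  simp [push, h1, reflect_projIcc_cornerDist]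

theorem push_apply_of_ne {n : ℕ} (k : Fin n → Bool) (i₀ : Fin n) (s : unitInterval)
    (t : Fin n → unitInterval) {i : Fin n} (hi : i ≠ i₀) (h : t i = unitEnd (k i)) :
    push k i₀ (s, t) i = unitEnd (k i) := by
  have h0 : cornerDist k t i = 0 := by simp [cornerDist, h, reflect_unitEnd]
  simp [push, hi, h0, reflect_zero]

/-- Let M be the largest distance. If direction `i₀` falls short of 1, then M > 1/2, and rescaling
by 1 + 2(1 - M) brings any distance equal to M to at least 1. This is what the factor 2 in `push` is
for. If no direction arrived, every distance would thus be smaller than M. -/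
theorem exists_push_one {n : ℕ} (k : Fin n → Bool) (i₀ : Fin n) (t : Fin n → unitInterval) :
    ∃ i, push k i₀ (1, t) i = unitEnd (!k i) := by
  set M := ‖cornerDist k t‖ with hM
  suffices h : ∃ i, 1 ≤ (if i = i₀ then cornerDist k t i + 2 * (1 - M)
      else cornerDist k t i * (1 + 2 * (1 - M))) by
    obtain ⟨i, hi⟩ := h
    refine ⟨i, ?_⟩
    have h1 := Set.projIcc_of_right_le (zero_le_one (α := ℝ)) hi
    simp only [push, Set.Icc.coe_one, mul_one, ← hM]
    rw [h1, ← reflect_one]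
    rfl
  by_contra! h
  have hM1 : M ≤ 1 := norm_cornerDist_le_one k t
  have h0 := h i₀
  rw [if_pos rfl] at h0
  have h0' := cornerDist_nonneg k t i₀
  have hM2 : 1 / 2 < M := by linarith
  have : M < M := by
    rw [hM, pi_norm_lt_iff (by linarith), ← hM]
    intro i
    rw [Real.norm_of_nonneg (cornerDist_nonneg k t i)]
    by_cases hi : i = i₀
    · subst hi; linarith
    · have h1 := h i
      rw [if_neg hi] at h1
      by_contra! h2
      have h3 : M * (1 + 2 * (1 - M)) ≤ cornerDist k t i * (1 + 2 * (1 - M)) :=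
        mul_le_mul_of_nonneg_right h2 (by linarith)
      -- M(1 + 2(1 - M)) - 1 = (1 - M)(2M - 1) ≥ 0.
      nlinarith [mul_nonneg (sub_nonneg.2 hM1) (by linarith : (0 : ℝ) ≤ 2 * M - 1)]
  exact lt_irrefl _ this

/-! ### Cells of the cube and corners -/

/-- A vertex entry of `c` that differs from `k` puts the whole cell in a facet missing the corner;
without such an entry, the edge entries can be filled in from `k`. -/
theorem fill_eq_or_facet {n m : ℕ} (c : (cube n).cells m) (k : Fin n → Bool) :
    (∃ s, GridCell.fill c s = k) ∨ ∃ i, ∀ t, cellCoord c t i = unitEnd (!k i) := by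
  induction n generalizing m with
  | zero => cases c; exact Or.inl ⟨Fin.elim0, Subsingleton.elim _ _⟩
  | succ n ih =>
    cases c with
    | vertex a c =>
      by_cases h : decide (a.val = 1) = k 0
      · rcases ih c (Fin.tail k) with ⟨s, hs⟩ | ⟨i, hi⟩
        · refine Or.inl ⟨s, ?_⟩
          simp only [GridCell.fill, h]
          exact (congrArg _ hs).trans (Fin.cons_self_tail k)
        · exact Or.inr ⟨i.succ, hi⟩
      · refine Or.inr ⟨0, fun t => ?_⟩
        simp only [cellCoord, Fin.cons_zero]
        congr 1
        revert h
        generalize decide (a.val = 1) = b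
        cases b <;> cases k 0 <;> simp
    | edge a c =>
      rcases ih c (Fin.tail k) with ⟨s, hs⟩ | ⟨i, hi⟩
      · refine Or.inl ⟨Fin.cons (k 0) s, ?_⟩
        simp only [GridCell.fill, Fin.cons_zero, Fin.tail_cons]
        exact (congrArg _ hs).trans (Fin.cons_self_tail k)
      · exact Or.inr ⟨i.succ, fun t => hi (Fin.tail t)⟩

/-- A cell is cut out of the cube by its constant coordinates, and these are read off from any one
of its corners. -/
theorem exists_cellCoord_eq {n m : ℕ} (c : (cube n).cells m) (s : Fin m → Bool)
    (τ : Fin n → unitInterval)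
    (h : ∀ i, (∀ t, cellCoord c t i = unitEnd (GridCell.fill c s i)) →
      τ i = unitEnd (GridCell.fill c s i)) : ∃ t, cellCoord c t = τ := by
  induction n generalizing m with
  | zero => exact ⟨fun _ => 0, Subsingleton.elim _ _⟩
  | succ n ih =>
    cases c with
    | vertex a c =>
      obtain ⟨t, ht⟩ := ih c s (Fin.tail τ) fun i hi => h i.succ hi
      refine ⟨t, ?_⟩
      simp only [cellCoord]
      refine (congrArg _ ht).trans ?_
      have h0 : τ 0 = unitEnd (decide (a.val = 1)) := h 0 fun t => rfl
      rw [← h0, Fin.cons_self_tail]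
    | edge a c =>
      obtain ⟨t, ht⟩ := ih c (Fin.tail s) (Fin.tail τ) fun i hi => h i.succ fun t => hi (Fin.tail t)
      refine ⟨Fin.cons (τ 0) t, ?_⟩
      simp only [cellCoord, Fin.cons_zero, Fin.tail_cons]
      exact (congrArg _ ht).trans (Fin.cons_self_tail τ)

/-- Controls where `push` can send a cell: if `c` does not extend in direction `i₀`, turning its
vertex entry there into an edge gives a cell `d` that does, with `c` as the facet on the side of the
corner. -/
theorem exists_thickening {n m : ℕ} (c : (cube n).cells m) (s : Fin m → Bool) (i₀ : Fin n) :
    (∃ t, cellCoord c t i₀ ≠ unitEnd (GridCell.fill c s i₀)) ∨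
      ∃ (d : (cube n).cells (m + 1)) (j : Fin (m + 1)) (s' : Fin (m + 1) → Bool),
        (cube n).face (GridCell.fill c s i₀) j d = c ∧ GridCell.fill d s' = GridCell.fill c s ∧
          ∃ t, cellCoord d t i₀ ≠ unitEnd (GridCell.fill c s i₀) := by
  have hne : ∀ b : Bool, unitEnd (!b) ≠ unitEnd b := fun b h => by
    simpa using unitEnd_injective h
  induction n generalizing m with
  | zero => exact i₀.elim0
  | succ n ih =>
    cases c with
    | vertex a c =>
      induction i₀ using Fin.cases with
      | zero =>
        refine Or.inr ⟨GridCell.edge (0 : Fin 1) c, 0, Fin.cons (decide (a.val = 1)) s, ?_, ?_,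
          Fin.cons (unitEnd (!decide (a.val = 1))) (fun _ => 0), hne _⟩
        · change GridCell.face _ 0 (GridCell.edge _ c) = _
          rw [GridCell.face_edge_zero]
          congr 1
          change Fin 2 at a
          fin_cases a <;> rfl
        · simp only [GridCell.fill, Fin.cons_zero, Fin.tail_cons]
      | succ i₀ =>
        rcases ih c s i₀ with ⟨t, ht⟩ | ⟨d, j, s', h1, h2, t, ht⟩
        · exact Or.inl ⟨t, ht⟩
        · refine Or.inr ⟨GridCell.vertex (n := n) (k := fun _ => 1) a d, j, s', ?_, ?_, t, ht⟩
          · exact (GridCell.face_vertex (k := fun _ => 1) _ j a d).trans (congrArg _ h1)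
          · simp only [GridCell.fill]
            exact congrArg _ h2
    | edge a c =>
      induction i₀ using Fin.cases with
      | zero => exact Or.inl ⟨Fin.cons (unitEnd (!s 0)) (fun _ => 0), hne _⟩
      | succ i₀ =>
        rcases ih c (Fin.tail s) i₀ with ⟨t, ht⟩ | ⟨d, j, s', h1, h2, t, ht⟩
        · exact Or.inl ⟨Fin.cons 0 t, ht⟩
        · refine Or.inr ⟨GridCell.edge (n := n) (k := fun _ => 1) a d, j.succ, Fin.cons (s 0) s', ?_, ?_, Fin.cons 0 t, ht⟩
          · exact (GridCell.face_edge_succ (k := fun _ => 1) _ j a d).trans (congrArg _ h1)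
          · simp only [GridCell.fill, Fin.cons_zero, Fin.tail_cons]
            exact congrArg _ h2

/-! ### Extending a homotopy of a cube to the whole geometric realization -/

section Corner

variable {P : PrecubicalSet.{u}} {n : ℕ} {x : P.cells n} {k : Fin n → Bool}

theorem mem_star_corner_sharp (hx : P.IsRegular x) {m : ℕ} (c : (cube n).cells m) :
    sharp c P x ∈ P.star (P.corner k x) m ↔ ∃ s, GridCell.fill c s = k := by
  rw [mem_star]
  refine exists_congr fun s => ?_
  rw [corner_sharp]
  exact hx.corner_injective.eq_iff

/-- On the faces of x the homotopy is `h`, elsewhere it is constant. Regularity makes the face of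
the cube representing a cell unique. A cell outside the star is fixed even if it belongs to the
cube, since it then lies in a facet missing the corner; so the only gluings to check beyond the
fixed cells start from a cell of the star, which is a face of x together with all its own faces. -/
theorem exists_extended_homotopy (hx : P.IsRegular x)
    (hstar : ∀ m : ℕ, P.star (P.corner k x) m ⊆ P.cubeImage x m)
    (h : unitInterval × (Fin n → unitInterval) → (Fin n → unitInterval)) (hc : Continuous h)
    (hfix : ∀ s t, (∃ i, t i = unitEnd (!k i)) → h (s, t) = t) :
    ∃ G : C(unitInterval × P.Realization, P.Realization),
      (∀ s m (c : (cube n).cells m) t,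
        G (s, P.point (sharp c P x) t) = P.point x (h (s, cellCoord c t))) ∧
      ∀ s m (y : P.cells m) t, y ∉ P.star (P.corner k x) m →
        G (s, P.point y t) = P.point y t := by
  classical
  let g : ∀ {m : ℕ}, P.cells m → (Fin m → unitInterval) → unitInterval → P.Realization :=
    fun {m} y t s => if hy : y ∈ P.cubeImage x m then P.point x (h (s, cellCoord hy.choose t))
      else P.point y t
  have g_sharp : ∀ {m : ℕ} (c : (cube n).cells m) t s,
      g (sharp c P x) t s = P.point x (h (s, cellCoord c t)) := by
    intro m c t s
    have hy : sharp c P x ∈ P.cubeImage x m := ⟨c, rfl⟩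
    have hc : hy.choose = c := hx m hy.choose_spec
    simp only [g, dif_pos hy, hc]
  have g_fix : ∀ {m : ℕ} (y : P.cells m) t s, y ∉ P.star (P.corner k x) m →
      g y t s = P.point y t := by
    intro m y t s hy
    by_cases hyc : y ∈ P.cubeImage x m
    · obtain ⟨c, rfl⟩ := hyc
      change sharp c P x ∉ _ at hy
      change g (sharp c P x) t s = P.point (sharp c P x) t
      rw [g_sharp, point_sharp]
      rw [mem_star_corner_sharp hx] at hy
      obtain ⟨i, hi⟩ := (fill_eq_or_facet c k).resolve_left hy
      rw [hfix s _ ⟨i, hi t⟩]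
    · simp only [g, dif_neg hyc]
  have g_face : ∀ {m : ℕ} (y : P.cells (m + 1)) (ε : Bool) (i : Fin (m + 1)) t s,
      g (P.face ε i y) t s =
        g y (i.insertNth (α := fun _ => unitInterval) (unitEnd ε) t) s := by
    intro m y ε i t s
    by_cases hy : y ∈ P.star (P.corner k x) (m + 1)
    · obtain ⟨c, rfl⟩ := hstar _ hy
      change g (P.face ε i (sharp c P x)) t s = g (sharp c P x) _ s
      rw [← sharp_face, g_sharp, g_sharp, cellCoord_face]
    · rw [g_fix y _ s hy, g_fix _ t s, point_face]
      exact (P.starComplement (P.corner k x)).face_mem ε i hy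
  have g_cont : ∀ {m : ℕ} (y : P.cells m),
      Continuous (fun p : (Fin m → unitInterval) × unitInterval => g y p.1 p.2) := by
    intro m y
    by_cases hy : y ∈ P.cubeImage x m
    · simp only [g, dif_pos hy]
      exact (P.continuous_point x).comp (hc.comp (continuous_snd.prodMk
        ((continuous_cellCoord hy.choose).comp continuous_fst)))
    · simp only [g, dif_neg hy]
      exact (P.continuous_point y).comp continuous_fst
  -- Currying lets the homotopy descend to the quotient |P| without having to know that its product
  -- with the interval is again a quotient; uncurrying is possible because the interval is locally
  -- compact.
  let G' : C(P.Realization, C(unitInterval, P.Realization)) :=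
    ⟨Quot.lift (fun p => (⟨fun s => g p.1.2 p.2 s,
        (g_cont p.1.2).comp (continuous_const.prodMk continuous_id)⟩ :
          C(unitInterval, P.Realization))) (by
        rintro _ _ ⟨y, ε, i, t⟩
        ext s
        exact g_face y ε i t s),
      continuous_quot_lift _ (continuous_sigma fun c =>
        (ContinuousMap.curry ⟨_, g_cont c.2⟩).continuous)⟩
  refine ⟨G'.uncurry.comp ContinuousMap.prodSwap, fun s m c t => g_sharp c t s,
    fun s m y t hy => g_fix y t s hy⟩

/-- In the last clause, a point of a cell `c` of the star is pushed within `c` or within its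
thickening `d` in direction `i₀`. Passing from `c` to `d` only adds vertices at the other ends of
edges in direction `i₀`, so the closure condition on `U` keeps `d` in the full subset. -/
theorem exists_push_homotopy (hx : P.IsRegular x)
    (hstar : ∀ m : ℕ, P.star (P.corner k x) m ⊆ P.cubeImage x m) (i₀ : Fin n) :
    ∃ G : C(unitInterval × P.Realization, P.Realization),
      (∀ p, G (0, p) = p) ∧
      (∀ s, ∀ p ∈ Set.range (P.starComplement (P.corner k x)).incl.realization, G (s, p) = p) ∧
      (∀ p, G (1, p) ∈ Set.range (P.starComplement (P.corner k x)).incl.realization) ∧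
      ∀ U : Set (P.cells 0),
        (∀ e : P.cells 1, P.face (k i₀) 0 e ∈ U → P.face (!k i₀) 0 e ∈ U) →
        ∀ p ∈ Set.range (P.fullSubset U).incl.realization,
          G (1, p) ∈ Set.range (P.fullSubset U).incl.realization := by
  obtain ⟨G, hG, hG'⟩ := exists_extended_homotopy hx hstar (push k i₀) (continuous_push k i₀)
    (push_of_facet k i₀)
  refine ⟨G, fun p => ?_, ?_, fun p => ?_, ?_⟩
  · obtain ⟨m, y, t, rfl⟩ := P.exists_point p
    by_cases hy : y ∈ P.star (P.corner k x) m
    · obtain ⟨c, rfl⟩ := hstar _ hy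
      change G (0, P.point (sharp c P x) t) = P.point (sharp c P x) t
      rw [hG, push_zero, point_sharp]
    · exact hG' _ _ _ _ hy
  · rintro s _ ⟨q, rfl⟩
    obtain ⟨m, y, t, rfl⟩ := (P.starComplement (P.corner k x)).toPrecubicalSet.exists_point q
    exact hG' _ _ _ _ y.2
  · obtain ⟨m, y, t, rfl⟩ := P.exists_point p
    by_cases hy : y ∈ P.star (P.corner k x) m
    · obtain ⟨c, rfl⟩ := hstar _ hy
      change G (1, P.point (sharp c P x) t) ∈ _
      rw [hG]
      obtain ⟨i, hi⟩ := exists_push_one k i₀ (cellCoord c t)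
      cases n with
      | zero => exact i.elim0
      | succ n =>
        rw [P.point_eq_face x _ hi]
        refine Subset.point_mem_range _ (mem_starComplement.2 fun s hs => ?_) _
        rw [← corner_insertNth] at hs
        have := congrFun (hx.corner_injective hs) i
        simp at this
    · rw [hG' _ _ _ _ hy]
      exact Subset.point_mem_range _ hy t
  · rintro U hU _ ⟨q, rfl⟩
    obtain ⟨m, ⟨y, hyU⟩, t, rfl⟩ := (P.fullSubset U).toPrecubicalSet.exists_point q
    change G (1, P.point y t) ∈ _
    by_cases hy : y ∈ P.star (P.corner k x) m
    · obtain ⟨c, rfl⟩ := hstar _ hy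
      change sharp c P x ∈ _ at hy
      change G (1, P.point (sharp c P x) t) ∈ _
      rw [hG]
      obtain ⟨s, rfl⟩ := (mem_star_corner_sharp hx c).1 hy
      rcases exists_thickening c s i₀ with ⟨t₀, ht₀⟩ | ⟨d, j, s', hd, hs', t₀, ht₀⟩
      -- Here `c` extends in direction `i₀`, so its constant coordinates are in other directions,
      -- where the push keeps the value of the corner.
      · obtain ⟨t', ht'⟩ := exists_cellCoord_eq c s (push (GridCell.fill c s) i₀ (1, cellCoord c t))
          fun i hi => push_apply_of_ne _ _ _ _ (fun h => ht₀ (h ▸ hi t₀)) (hi t)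
        rw [← ht', ← point_sharp]
        exact Subset.point_mem_range _ hyU t'
      · obtain ⟨t', ht'⟩ := exists_cellCoord_eq d s' (push (GridCell.fill c s) i₀ (1, cellCoord c t))
          fun i hi => by
            rw [hs'] at hi ⊢
            refine push_apply_of_ne _ _ _ _ (fun h => ht₀ (h ▸ hi t₀)) ?_
            conv_lhs => rw [← hd]
            rw [cellCoord_face]
            exact hi _
        rw [← ht', ← point_sharp]
        refine Subset.point_mem_range _ (mem_fullSubset_of_face hU (j := j) ?_) t'
        rw [← sharp_face, hd]
        exact hyU
    · rw [hG' _ _ _ _ hy]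
      exact Subset.point_mem_range _ hyU t

end Corner

/-! ### Functoriality and homotopy invariance of homology -/

section Homology

variable (R : Type w) [CommRing R] (p : ℕ)

theorem homologyMap_comp {P Q S : PrecubicalSet.{u}} (g : C(Q.Realization, S.Realization))
    (f : C(P.Realization, Q.Realization)) (α : H R p P) :
    homologyMap R p (g.comp f) α = homologyMap R p g (homologyMap R p f α) := by
  unfold homologyMap
  rw [TopCat.ofHom_comp, Functor.map_comp]
  rfl

theorem homologyMap_id {P : PrecubicalSet.{u}} (α : H R p P) :
    homologyMap R p (ContinuousMap.id P.Realization) α = α := by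
  unfold homologyMap
  rw [TopCat.ofHom_id, CategoryTheory.Functor.map_id]
  rfl

theorem homologyMap_congr {P Q : PrecubicalSet.{u}} {f g : C(P.Realization, Q.Realization)}
    (h : f.Homotopic g) (α : H R p P) : homologyMap R p f α = homologyMap R p g α := by
  obtain ⟨F⟩ := h
  unfold homologyMap
  have F' : TopCat.Homotopy (TopCat.ofHom f) (TopCat.ofHom g) := F
  have e := F'.congr_homologyMap_singularChainComplexFunctor
    (ModuleCat.of R (ULift.{u} R) : ModuleCat.{max u w} R) p
  have e' : (homology.{u, w} R p).map (TopCat.ofHom f) =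
    (homology.{u, w} R p).map (TopCat.ofHom g) := e
  rw [e']

theorem homologyMap_bijective {P Q : PrecubicalSet.{u}}
    (e : ContinuousMap.HomotopyEquiv P.Realization Q.Realization) :
    Function.Bijective (homologyMap R p e.toFun) := by
  refine Function.bijective_iff_has_inverse.2 ⟨homologyMap R p e.invFun, fun α => ?_, fun α => ?_⟩
  · rw [← homologyMap_comp, homologyMap_congr R p e.left_inv, homologyMap_id]
  · rw [← homologyMap_comp, homologyMap_congr R p e.right_inv, homologyMap_id]

end Homology

theorem exists_lift_of_isEmbedding {A B X : Type*} [TopologicalSpace A] [TopologicalSpace B]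
    [TopologicalSpace X] {E : C(X, B)} (hE : Topology.IsEmbedding E) (g : C(A, B))
    (hg : ∀ a, g a ∈ Set.range E) : ∃ r : C(A, X), ∀ a, E (r a) = g a := by
  choose r hr using hg
  refine ⟨⟨r, hE.isInducing.continuous_iff.2 ?_⟩, hr⟩
  have : E ∘ r = g := funext hr
  rw [this]
  exact g.continuous

/-! ### Comparison of subsets -/

/-- The morphism of precubical subsets that covers a given morphism. -/
def Subset.mapHom {P Q : PrecubicalSet.{u}} (f : Hom P Q) (X : P.Subset) (Y : Q.Subset)
    (h : ∀ n, ∀ y ∈ X.carrier n, f.app y ∈ Y.carrier n) : Hom X.toPrecubicalSet Y.toPrecubicalSet where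
  app y := ⟨f.app y.1, h _ _ y.2⟩
  app_face ε i y := Subtype.ext (f.app_face ε i y.1)

theorem Subset.incl_comp_mapHom {P Q : PrecubicalSet.{u}} (f : Hom P Q) (X : P.Subset)
    (Y : Q.Subset) (h : ∀ n, ∀ y ∈ X.carrier n, f.app y ∈ Y.carrier n) :
    Y.incl.realization.comp (X.mapHom f Y h).realization =
      f.realization.comp X.incl.realization := by
  ext p
  obtain ⟨n, y, t, rfl⟩ := X.toPrecubicalSet.exists_point p
  rfl

theorem range_homologyMap_mono (R : Type w) [CommRing R] (p : ℕ) {P Q : PrecubicalSet.{u}}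
    (f : Hom P Q) (X : P.Subset) (Y : Q.Subset)
    (h : ∀ n, ∀ y ∈ X.carrier n, f.app y ∈ Y.carrier n) {α : H R p P}
    (hα : α ∈ Set.range (homologyMap R p X.incl.realization)) :
    homologyMap R p f.realization α ∈ Set.range (homologyMap R p Y.incl.realization) := by
  obtain ⟨γ, rfl⟩ := hα
  exact ⟨homologyMap R p (X.mapHom f Y h).realization γ, by
    rw [← homologyMap_comp, ← homologyMap_comp, Subset.incl_comp_mapHom]⟩

/-- The identity morphism. -/
def Hom.id (P : PrecubicalSet.{u}) : Hom P P where
  app y := y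
  app_face _ _ _ := rfl

theorem Hom.id_realization (P : PrecubicalSet.{u}) :
    (Hom.id P).realization = ContinuousMap.id P.Realization := by
  ext p
  obtain ⟨n, y, t, rfl⟩ := P.exists_point p
  rfl

/-- The image of a precubical subset of a precubical subset. -/
def Subset.image {P : PrecubicalSet.{u}} (X : P.Subset) (Y : X.toPrecubicalSet.Subset) :
    P.Subset where
  carrier n := {y | ∃ h : y ∈ X.carrier n, (⟨y, h⟩ : X.toPrecubicalSet.cells n) ∈ Y.carrier n}
  face_mem := by
    rintro n ε i y ⟨h, hy⟩
    exact ⟨X.face_mem ε i h, Y.face_mem ε i hy⟩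

/-- A morphism of precubical sets acts on vertices and edges. -/
def Hom.prefunctor {P Q : PrecubicalSet.{u}} (f : Hom P Q) : P.Vertex ⥤q Q.Vertex where
  obj a := f.app (P := P) (n := 0) a
  map e := ⟨f.app e.1, by rw [← f.app_face, e.2.1], by rw [← f.app_face, e.2.2]⟩

theorem Reach.map {P Q : PrecubicalSet.{u}} (f : Hom P Q) {a b : P.cells 0} (h : P.Reach a b) :
    Q.Reach (f.app a) (f.app b) :=
  h.elim fun ω => ⟨f.prefunctor.mapPath ω⟩

theorem Reach.trans {P : PrecubicalSet.{u}} {a b c : P.cells 0} (h : P.Reach a b)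
    (h' : P.Reach b c) : P.Reach a c :=
  h.elim fun ω => h'.elim fun ν => ⟨ω.comp ν⟩

theorem reach_edge (P : PrecubicalSet.{u}) (e : P.cells 1) :
    P.Reach (P.face false 0 e) (P.face true 0 e) :=
  ⟨Quiver.Hom.toPath (V := P.Vertex) ⟨e, rfl, rfl⟩⟩

/-! ### Homotopy equivalence and homology graph -/

section Corner

variable {P : PrecubicalSet.{u}} {n : ℕ} {x : P.cells n} {k : Fin n → Bool}

theorem exists_homotopyEquiv (hx : P.IsRegular x)
    (hstar : ∀ m : ℕ, P.star (P.corner k x) m ⊆ P.cubeImage x m) (i₀ : Fin n) :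
    ∃ e : ContinuousMap.HomotopyEquiv
      (P.starComplement (P.corner k x)).toPrecubicalSet.Realization P.Realization,
      e.toFun = (P.starComplement (P.corner k x)).incl.realization := by
  obtain ⟨G, h0, hQ, h1, -⟩ := exists_push_homotopy hx hstar i₀
  have hE := (P.starComplement (P.corner k x)).isClosedEmbedding_incl.isEmbedding
  obtain ⟨r, hr⟩ := exists_lift_of_isEmbedding hE
    (G.comp ((ContinuousMap.const _ 1).prodMk (ContinuousMap.id _))) h1
  refine ⟨⟨(P.starComplement (P.corner k x)).incl.realization, r, ?_, ?_⟩, rfl⟩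
  · have : r.comp (P.starComplement (P.corner k x)).incl.realization = ContinuousMap.id _ := by
      ext q
      exact hE.injective ((hr _).trans (hQ 1 _ ⟨q, rfl⟩))
    rw [this]
  · refine ContinuousMap.Homotopic.symm ⟨⟨G, fun p => h0 p, fun p => (hr p).symm⟩⟩

/-- The end of the push maps the realization of the full subset on `U` into that of its part in the
complement, and as a map to |P| it is homotopic to the inclusion. A preimage of the class can thus
be pushed into the complement; its image there is `α`, because the inclusion is injective in
homology. -/
theorem mem_range_homologyMap_of_incl (R : Type w) [CommRing R] (p : ℕ) (hx : P.IsRegular x)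
    (hstar : ∀ m : ℕ, P.star (P.corner k x) m ⊆ P.cubeImage x m) (i₀ : Fin n)
    (U : Set (P.cells 0))
    (hU : ∀ e : P.cells 1, P.face (k i₀) 0 e ∈ U → P.face (!k i₀) 0 e ∈ U)
    (α : H R p (P.starComplement (P.corner k x)).toPrecubicalSet)
    (hα : homologyMap R p (P.starComplement (P.corner k x)).incl.realization α ∈
      Set.range (homologyMap R p (P.fullSubset U).incl.realization)) :
    α ∈ Set.range (homologyMap R p
      ((P.starComplement (P.corner k x)).toPrecubicalSet.fullSubset
        {a | a.1 ∈ U}).incl.realization) := by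
  set Q := P.starComplement (P.corner k x) with hQ
  set X := Q.toPrecubicalSet.fullSubset {a | a.1 ∈ U} with hX
  obtain ⟨G, h0, -, h1, hGU⟩ := exists_push_homotopy hx hstar i₀
  let E : C(X.toPrecubicalSet.Realization, P.Realization) :=
    Q.incl.realization.comp X.incl.realization
  have hE : Topology.IsEmbedding E :=
    Q.isClosedEmbedding_incl.isEmbedding.comp X.isClosedEmbedding_incl.isEmbedding
  -- The cell carrying a point in its interior decides membership in each subspace, so the two
  -- conditions combine to the intersection of the subsets.
  have hrange : ∀ q ∈ Set.range (P.fullSubset U).incl.realization,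
      q ∈ Set.range Q.incl.realization → q ∈ Set.range E := by
    intro q hqU hqQ
    rw [Subset.mem_range_incl] at hqU hqQ
    refine ⟨X.toPrecubicalSet.point ⟨⟨_, hqQ⟩, fun s => ?_⟩ (P.pointForm q).2,
      P.point_pointForm q⟩
    have := app_corner Q.incl s (⟨_, hqQ⟩ : Q.toPrecubicalSet.cells _)
    change Q.incl.app _ ∈ U
    rw [this]
    exact hqU s
  obtain ⟨r, hr⟩ := exists_lift_of_isEmbedding hE
    ((G.comp ((ContinuousMap.const _ 1).prodMk (ContinuousMap.id _))).comp
      (P.fullSubset U).incl.realization)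
    (fun a => hrange _ (hGU U hU _ ⟨a, rfl⟩) (h1 _))
  have hhom : (E.comp r).Homotopic (P.fullSubset U).incl.realization := by
    refine ContinuousMap.Homotopic.symm
      ⟨⟨G.comp ((ContinuousMap.id _).prodMap (P.fullSubset U).incl.realization),
        fun p => h0 _, fun p => (hr p).symm⟩⟩
  obtain ⟨e, he⟩ := exists_homotopyEquiv hx hstar i₀
  have hinj := (homologyMap_bijective R p e).injective
  rw [he] at hinj
  obtain ⟨γ, hγ⟩ := hα
  refine ⟨homologyMap R p r γ, hinj ?_⟩
  rw [← hγ, ← homologyMap_congr R p hhom, homologyMap_comp, ← homologyMap_comp]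

/-- The inclusion clearly preserves ↗. To reflect it, the witnessing subsets are enlarged until
pushes in suitable directions preserve them; one direction of each kind is needed. -/
theorem isHomologyGraphIso_incl (R : Type w) [CommRing R] (hx : P.IsRegular x)
    (hstar : ∀ m : ℕ, P.star (P.corner k x) m ⊆ P.cubeImage x m)
    (hk0 : ∃ i, k i = false) (hk1 : ∃ i, k i = true)
    (hreach : ∀ a b : (P.starComplement (P.corner k x)).toPrecubicalSet.cells 0,
      P.Reach a.1 b.1 → (P.starComplement (P.corner k x)).toPrecubicalSet.Reach a b) :
    IsHomologyGraphIso R (P.starComplement (P.corner k x)).incl.realization := by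
  obtain ⟨i₀, hi₀⟩ := hk1
  obtain ⟨j₀, hj₀⟩ := hk0
  refine ⟨fun p => ?_, fun p q α β => ⟨?_, ?_⟩⟩
  · obtain ⟨e, he⟩ := exists_homotopyEquiv hx hstar i₀
    rw [← he]
    exact homologyMap_bijective R p e
  · rintro ⟨X, Y, hα, hβ, h⟩
    refine ⟨Subset.image _ X, Subset.image _ Y,
      range_homologyMap_mono R p (P.starComplement (P.corner k x)).incl X (Subset.image _ X)
        (fun n y hy => ⟨y.2, hy⟩) hα,
      range_homologyMap_mono R q (P.starComplement (P.corner k x)).incl Y (Subset.image _ Y)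
        (fun n y hy => ⟨y.2, hy⟩) hβ, ?_⟩
    rintro a ⟨_, ha⟩ b ⟨_, hb⟩
    exact (h _ ha _ hb).map (P.starComplement (P.corner k x)).incl
  · rintro ⟨X, Y, hα, hβ, h⟩
    -- U absorbs predecessors and V absorbs successors, while every vertex of U still reaches every
    -- vertex of V.
    let U : Set (P.cells 0) := {a | ∀ b ∈ Y.carrier 0, P.Reach a b}
    let V : Set (P.cells 0) := {b | ∀ a ∈ U, P.Reach a b}
    have hXU : ∀ n, ∀ y ∈ X.carrier n, (Hom.id P).app y ∈ (P.fullSubset U).carrier n :=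
      fun n y hy s b hb => h _ (X.corner_mem hy s) b hb
    have hYV : ∀ n, ∀ y ∈ Y.carrier n, (Hom.id P).app y ∈ (P.fullSubset V).carrier n :=
      fun n y hy s a ha => ha _ (Y.corner_mem hy s)
    have hα' := range_homologyMap_mono R p (Hom.id P) X _ hXU hα
    have hβ' := range_homologyMap_mono R q (Hom.id P) Y _ hYV hβ
    rw [Hom.id_realization, homologyMap_id] at hα' hβ'
    refine ⟨_, _, mem_range_homologyMap_of_incl R p hx hstar i₀ U ?_ α hα',
      mem_range_homologyMap_of_incl R q hx hstar j₀ V ?_ β hβ', ?_⟩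
    · intro e he b hb
      rw [hi₀] at he ⊢
      exact (P.reach_edge e).trans (he b hb)
    · intro e he a ha
      rw [hj₀] at he ⊢
      exact (he a ha).trans (P.reach_edge e)
    · intro a ha b hb
      exact hreach a b (hb Fin.elim0 _ (ha Fin.elim0))

end Corner

/-! ### The fundamental category -/

/-- A vertex as an object of the fundamental category. -/
def toFundamental (P : PrecubicalSet.{u}) (a : P.cells 0) : P.FundamentalCategory := ⟨a⟩

/-- The morphism of the fundamental category given by an edge. -/
def edgeClass (P : PrecubicalSet.{u}) (e : P.cells 1) {a b : P.cells 0}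
    (ha : P.face false 0 e = a) (hb : P.face true 0 e = b) :
    P.toFundamental a ⟶ P.toFundamental b :=
  P.dihomotopyClass (Quiver.Hom.toPath (V := P.Vertex) ⟨e, ha, hb⟩)

theorem dihomotopyClass_comp (P : PrecubicalSet.{u}) {a b c : P.Vertex} (ω : P.Path a b)
    (ν : P.Path b c) :
    P.dihomotopyClass (ω.comp ν) = P.dihomotopyClass ω ≫ P.dihomotopyClass ν := rfl

theorem dihomotopyClass_cons (P : PrecubicalSet.{u}) {a b c : P.Vertex} (ω : P.Path a b)
    (e : b ⟶ c) :
    P.dihomotopyClass (ω.cons e) = P.dihomotopyClass ω ≫ P.edgeClass e.1 e.2.1 e.2.2 := rfl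

theorem edgeClass_square (P : PrecubicalSet.{u}) (z : P.cells 2) {a b b' c : P.cells 0}
    {e₁ e₂ g₁ g₂ : P.cells 1} (he₁ : e₁ = P.face false 0 z) (he₂ : e₂ = P.face true 1 z)
    (hg₁ : g₁ = P.face false 1 z) (hg₂ : g₂ = P.face true 0 z)
    (h₁ : P.face false 0 e₁ = a) (h₂ : P.face true 0 e₁ = b)
    (h₃ : P.face false 0 e₂ = b) (h₄ : P.face true 0 e₂ = c)
    (h₅ : P.face false 0 g₁ = a) (h₆ : P.face true 0 g₁ = b')
    (h₇ : P.face false 0 g₂ = b') (h₈ : P.face true 0 g₂ = c) :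
    P.edgeClass e₁ h₁ h₂ ≫ P.edgeClass e₂ h₃ h₄ = P.edgeClass g₁ h₅ h₆ ≫ P.edgeClass g₂ h₇ h₈ :=
  CategoryTheory.Quotient.sound P.SquareRel
    (SquareRel.square z (⟨e₁, h₁, h₂⟩ : (a : P.Vertex) ⟶ b) ⟨e₂, h₃, h₄⟩ ⟨g₁, h₅, h₆⟩ ⟨g₂, h₇, h₈⟩
      he₁ he₂ hg₁ hg₂)

theorem edgeAt_congr {P : PrecubicalSet.{u}} {n : ℕ} {x : P.cells n} {s s' : Fin n → Bool}
    {i : Fin n} (h : ∀ a ≠ i, s a = s' a) : P.edgeAt s i x = P.edgeAt s' i x := by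
  rw [← edgeAt_update P s' i x (s i)]
  congr 1
  funext a
  by_cases ha : a = i
  · subst ha; simp
  · simp [ha, h a ha]

theorem face_edgeAt_eq {P : PrecubicalSet.{u}} {n : ℕ} {x : P.cells n} {s s' : Fin n → Bool}
    {i : Fin n} {ε : Bool} (h : Function.update s i ε = s') :
    P.face ε 0 (P.edgeAt s i x) = P.corner s' x := by
  rw [face_edgeAt, h]

/-! ### Squares and detours in the complement -/

section Corner

variable {P : PrecubicalSet.{u}} {a₀ : P.cells 0}

/-- An edge of `P` between vertices different from `a₀`, as a morphism of the fundamental category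
of the complement of the star of `a₀`. -/
def complEdge (w w' : (P.starComplement a₀).toPrecubicalSet.cells 0) (e : P.cells 1)
    (h : P.face false 0 e = w.1) (h' : P.face true 0 e = w'.1) :
    (P.starComplement a₀).toPrecubicalSet.toFundamental w ⟶
      (P.starComplement a₀).toPrecubicalSet.toFundamental w' :=
  edgeClass (P.starComplement a₀).toPrecubicalSet (⟨e, mem_starComplement.2 fun s => by
    rw [corner_succ]
    cases s 0
    · rw [h]; exact mem_starComplement.1 w.2 Fin.elim0
    · rw [h']; exact mem_starComplement.1 w'.2 Fin.elim0⟩ :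
      (P.starComplement a₀).toPrecubicalSet.cells 1) (Subtype.ext h) (Subtype.ext h')

/-- The four vertices of `z` differ from `a₀`, so `z` itself belongs to the complement. -/
theorem complEdge_square (z : P.cells 2)
    {w w₁ w₂ w₃ : (P.starComplement a₀).toPrecubicalSet.cells 0}
    {e₁ e₂ g₁ g₂ : P.cells 1} (he₁ : e₁ = P.face false 0 z) (he₂ : e₂ = P.face true 1 z)
    (hg₁ : g₁ = P.face false 1 z) (hg₂ : g₂ = P.face true 0 z)
    (h₁ : P.face false 0 e₁ = w.1) (h₂ : P.face true 0 e₁ = w₁.1)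
    (h₃ : P.face false 0 e₂ = w₁.1) (h₄ : P.face true 0 e₂ = w₃.1)
    (h₅ : P.face false 0 g₁ = w.1) (h₆ : P.face true 0 g₁ = w₂.1)
    (h₇ : P.face false 0 g₂ = w₂.1) (h₈ : P.face true 0 g₂ = w₃.1) :
    complEdge w w₁ e₁ h₁ h₂ ≫ complEdge w₁ w₃ e₂ h₃ h₄ =
      complEdge w w₂ g₁ h₅ h₆ ≫ complEdge w₂ w₃ g₂ h₇ h₈ := by
  have hz : z ∈ (P.starComplement a₀).carrier 2 := mem_starComplement.2 fun s => by
    rw [corner_succ, corner_succ]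
    have hw := fun y : (P.starComplement a₀).toPrecubicalSet.cells 0 =>
      mem_starComplement.1 y.2 Fin.elim0
    change P.face (s 1) 0 (P.face (s 0) 0 z) ≠ a₀
    cases s 0
    · rw [← he₁]
      cases s 1
      · rw [h₁]; exact hw w
      · rw [h₂]; exact hw w₁
    · rw [← hg₂]
      cases s 1
      · rw [h₇]; exact hw w₂
      · rw [h₈]; exact hw w₃
  exact edgeClass_square (P.starComplement a₀).toPrecubicalSet ⟨z, hz⟩ (Subtype.ext he₁)
    (Subtype.ext he₂) (Subtype.ext hg₁) (Subtype.ext hg₂) _ _ _ _ _ _ _ _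

theorem complEdge_comm {n : ℕ} {x : P.cells n} (s : Fin n → Bool) {i j : Fin n} (hij : i ≠ j)
    {w w₁ w₂ w₃ : (P.starComplement a₀).toPrecubicalSet.cells 0}
    {e₁ e₂ g₁ g₂ : P.cells 1}
    (he₁ : e₁ = P.edgeAt (Function.update s i false) j x)
    (he₂ : e₂ = P.edgeAt (Function.update s j true) i x)
    (hg₁ : g₁ = P.edgeAt (Function.update s j false) i x)
    (hg₂ : g₂ = P.edgeAt (Function.update s i true) j x)
    (h₁ : P.face false 0 e₁ = w.1) (h₂ : P.face true 0 e₁ = w₁.1)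
    (h₃ : P.face false 0 e₂ = w₁.1) (h₄ : P.face true 0 e₂ = w₃.1)
    (h₅ : P.face false 0 g₁ = w.1) (h₆ : P.face true 0 g₁ = w₂.1)
    (h₇ : P.face false 0 g₂ = w₂.1) (h₈ : P.face true 0 g₂ = w₃.1) :
    complEdge w w₁ e₁ h₁ h₂ ≫ complEdge w₁ w₃ e₂ h₃ h₄ =
      complEdge w w₂ g₁ h₅ h₆ ≫ complEdge w₂ w₃ g₂ h₇ h₈ := by
  rcases lt_or_gt_of_ne hij with h | h
  · obtain ⟨z, hz⟩ := P.exists_isSquareAt x s h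
    exact complEdge_square z (he₁.trans (hz false).1.symm) (he₂.trans (hz true).2.symm)
      (hg₁.trans (hz false).2.symm) (hg₂.trans (hz true).1.symm) _ _ _ _ _ _ _ _
  · obtain ⟨z, hz⟩ := P.exists_isSquareAt x s h
    exact (complEdge_square z (hg₁.trans (hz false).1.symm) (hg₂.trans (hz true).2.symm)
      (he₁.trans (hz false).2.symm) (he₂.trans (hz true).1.symm) _ _ _ _ _ _ _ _).symm

variable {n : ℕ} {x : P.cells n} {k : Fin n → Bool}

/-- The vertex of the cube with coordinates `s ≠ k`. -/
def complVertex (hx : P.IsRegular x) (s : Fin n → Bool) (hs : s ≠ k) :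
    (P.starComplement (P.corner k x)).toPrecubicalSet.cells 0 :=
  ⟨P.corner s x, mem_starComplement.2 fun _ h =>
    hs (hx.corner_injective ((show P.corner s x = P.corner k x from h)))⟩

theorem complVertex_val (hx : P.IsRegular x) (s : Fin n → Bool) (hs : s ≠ k) :
    (complVertex hx s hs).1 = P.corner s x := rfl

/-- The path along the two edges that avoid the corner `k` of the square in the directions `i` and `j`
at this corner, where `k i = 1` and `k j = 0`. -/
def detour (hx : P.IsRegular x) {i j : Fin n} (hi : k i = true) (hj : k j = false)
    (w w' : (P.starComplement (P.corner k x)).toPrecubicalSet.cells 0)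
    (hw : w.1 = P.corner (Function.update k i false) x)
    (hw' : w'.1 = P.corner (Function.update k j true) x) :
    (P.starComplement (P.corner k x)).toPrecubicalSet.toFundamental w ⟶
      (P.starComplement (P.corner k x)).toPrecubicalSet.toFundamental w' :=
  complEdge w (complVertex hx (Function.update (Function.update k i false) j true)
      (fun h => by simpa [hj] using congrFun h j)) (P.edgeAt (Function.update k i false) j x)
      (by rw [hw]; exact face_edgeAt_eq (by grind [Function.update_apply]))
      (by rw [complVertex_val]; exact face_edgeAt_eq rfl) ≫
    complEdge _ w' (P.edgeAt (Function.update k j true) i x)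
      (by rw [complVertex_val]; exact face_edgeAt_eq (by grind [Function.update_apply]))
      (by rw [hw']; exact face_edgeAt_eq (by grind [Function.update_apply]))

/-- In the directions i, j, l the corner is (1,0,0). Both sides run from (0,0,0) to (1,1,1), and the
three facets avoiding the corner, with coordinate 0 in direction i or 1 in direction j or l, deform
one into the other through M = (0,1,1). -/
theorem detour_comp (hx : P.IsRegular x) {i j l : Fin n} (hi : k i = true) (hj : k j = false)
    (hl : k l = false) (hjl : j ≠ l)
    (w wj wl w' : (P.starComplement (P.corner k x)).toPrecubicalSet.cells 0)
    (hw : w.1 = P.corner (Function.update k i false) x)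
    (hwj : wj.1 = P.corner (Function.update k j true) x)
    (hwl : wl.1 = P.corner (Function.update k l true) x)
    (h₁ : P.face false 0 (P.edgeAt (Function.update k j true) l x) = wj.1)
    (h₂ : P.face true 0 (P.edgeAt (Function.update k j true) l x) = w'.1)
    (h₃ : P.face false 0 (P.edgeAt (Function.update k l true) j x) = wl.1)
    (h₄ : P.face true 0 (P.edgeAt (Function.update k l true) j x) = w'.1) :
    detour hx hi hj w wj hw hwj ≫ complEdge wj w' _ h₁ h₂ =
      detour hx hi hl w wl hw hwl ≫ complEdge wl w' _ h₃ h₄ := by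
  have hij : i ≠ j := fun h => by simp [h, hj] at hi
  have hil : i ≠ l := fun h => by simp [h, hl] at hi
  let Mj := complVertex hx (k := k) (Function.update (Function.update k i false) j true)
    (fun h => by simpa [hj] using congrFun h j)
  let Ml := complVertex hx (k := k) (Function.update (Function.update k i false) l true)
    (fun h => by simpa [hl] using congrFun h l)
  let M := complVertex hx (k := k)
    (Function.update (Function.update (Function.update k i false) j true) l true)
    (fun h => by simpa [hl] using congrFun h l)
  have h₂' : P.corner (Function.update (Function.update k j true) l true) x = w'.1 := by
    rw [← h₂]; exact (face_edgeAt_eq rfl).symm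
  have f₁ : P.face false 0 (P.edgeAt (Function.update (Function.update k i false) j true) l x) =
      Mj.1 := face_edgeAt_eq (by clear * - hi hj hl hij hil hjl; grind [Function.update_apply])
  have f₂ : P.face true 0 (P.edgeAt (Function.update (Function.update k i false) j true) l x) =
      M.1 := face_edgeAt_eq (by clear * - hi hj hl hij hil hjl; grind [Function.update_apply])
  have f₃ : P.face false 0 (P.edgeAt (Function.update (Function.update k j true) l true) i x) =
      M.1 := face_edgeAt_eq (by clear * - hi hj hl hij hil hjl; grind [Function.update_apply])
  have f₄ : P.face true 0 (P.edgeAt (Function.update (Function.update k j true) l true) i x) =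
      w'.1 := by
    rw [← h₂']
    exact face_edgeAt_eq (by clear * - hi hj hl hij hil hjl; grind [Function.update_apply])
  have f₅ : P.face false 0 (P.edgeAt (Function.update (Function.update k i false) l true) j x) =
      Ml.1 := face_edgeAt_eq (by clear * - hi hj hl hij hil hjl; grind [Function.update_apply])
  have f₆ : P.face true 0 (P.edgeAt (Function.update (Function.update k i false) l true) j x) =
      M.1 := face_edgeAt_eq (by clear * - hi hj hl hij hil hjl; grind [Function.update_apply])
  rw [detour, detour, Category.assoc, Category.assoc]
  rw [complEdge_comm (x := x) (w := Mj) (w₂ := M) (Function.update k j true) hil.symm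
    (edgeAt_congr (by clear * - hi hj hl hij hil hjl; grind [Function.update_apply])) (edgeAt_congr (by clear * - hi hj hl hij hil hjl; grind [Function.update_apply]))
    (edgeAt_congr (by clear * - hi hj hl hij hil hjl; grind [Function.update_apply])) (edgeAt_congr (by clear * - hi hj hl hij hil hjl; grind [Function.update_apply]))
    _ _ _ _ f₁ f₂ f₃ f₄]
  rw [complEdge_comm (x := x) (w := Ml) (w₂ := M) (Function.update k l true) hij.symm
    (edgeAt_congr (by clear * - hi hj hl hij hil hjl; grind [Function.update_apply])) (edgeAt_congr (by clear * - hi hj hl hij hil hjl; grind [Function.update_apply]))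
    (edgeAt_congr (by clear * - hi hj hl hij hil hjl; grind [Function.update_apply])) (edgeAt_congr (by clear * - hi hj hl hij hil hjl; grind [Function.update_apply]))
    _ _ _ _ f₅ f₆ f₃ f₄]
  rw [← Category.assoc, ← Category.assoc]
  congr 1
  exact complEdge_comm (x := x) (Function.update k i false) hjl.symm
    (edgeAt_congr (by clear * - hi hj hl hij hil hjl; grind [Function.update_apply])) (edgeAt_congr (by clear * - hi hj hl hij hil hjl; grind [Function.update_apply]))
    (edgeAt_congr (by clear * - hi hj hl hij hil hjl; grind [Function.update_apply])) (edgeAt_congr (by clear * - hi hj hl hij hil hjl; grind [Function.update_apply]))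
    _ _ _ _ _ _ _ _

/-- The dual 3-cube argument, with corner (1,1,0) in the directions i, j, l and M = (0,0,1). -/
theorem comp_detour (hx : P.IsRegular x) {i j l : Fin n} (hi : k i = true) (hj : k j = true)
    (hl : k l = false) (hij : i ≠ j)
    (w wi wj w' : (P.starComplement (P.corner k x)).toPrecubicalSet.cells 0)
    (hwi : wi.1 = P.corner (Function.update k i false) x)
    (hwj : wj.1 = P.corner (Function.update k j false) x)
    (hw' : w'.1 = P.corner (Function.update k l true) x)
    (h₁ : P.face false 0 (P.edgeAt (Function.update k i false) j x) = w.1)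
    (h₂ : P.face true 0 (P.edgeAt (Function.update k i false) j x) = wi.1)
    (h₃ : P.face false 0 (P.edgeAt (Function.update k j false) i x) = w.1)
    (h₄ : P.face true 0 (P.edgeAt (Function.update k j false) i x) = wj.1) :
    complEdge w wi _ h₁ h₂ ≫ detour hx hi hl wi w' hwi hw' =
      complEdge w wj _ h₃ h₄ ≫ detour hx hj hl wj w' hwj hw' := by
  have hil : i ≠ l := fun h => by simp [h, hl] at hi
  have hjl : j ≠ l := fun h => by simp [h, hl] at hj
  let Mi := complVertex hx (k := k) (Function.update (Function.update k i false) l true)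
    (fun h => by simpa [hl] using congrFun h l)
  let Mj := complVertex hx (k := k) (Function.update (Function.update k j false) l true)
    (fun h => by simpa [hl] using congrFun h l)
  let M := complVertex hx (k := k)
    (Function.update (Function.update (Function.update k i false) j false) l true)
    (fun h => by simpa [hl] using congrFun h l)
  have h₁' : P.corner (Function.update (Function.update k i false) j false) x = w.1 := by
    rw [← h₁]; exact (face_edgeAt_eq rfl).symm
  have f₁ : P.face false 0 (P.edgeAt (Function.update (Function.update k i false) j false) l x) =
      w.1 := by
    rw [← h₁']
    exact face_edgeAt_eq (by clear * - hi hj hl hij hil hjl; grind [Function.update_apply])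
  have f₂ : P.face true 0 (P.edgeAt (Function.update (Function.update k i false) j false) l x) =
      M.1 := face_edgeAt_eq (by clear * - hi hj hl hij hil hjl; grind [Function.update_apply])
  have f₃ : P.face false 0 (P.edgeAt (Function.update (Function.update k i false) l true) j x) =
      M.1 := face_edgeAt_eq (by clear * - hi hj hl hij hil hjl; grind [Function.update_apply])
  have f₄ : P.face true 0 (P.edgeAt (Function.update (Function.update k i false) l true) j x) =
      Mi.1 := face_edgeAt_eq (by clear * - hi hj hl hij hil hjl; grind [Function.update_apply])
  have f₅ : P.face false 0 (P.edgeAt (Function.update (Function.update k j false) l true) i x) =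
      M.1 := face_edgeAt_eq (by clear * - hi hj hl hij hil hjl; grind [Function.update_apply])
  have f₆ : P.face true 0 (P.edgeAt (Function.update (Function.update k j false) l true) i x) =
      Mj.1 := face_edgeAt_eq (by clear * - hi hj hl hij hil hjl; grind [Function.update_apply])
  rw [detour, detour, ← Category.assoc, ← Category.assoc]
  rw [complEdge_comm (x := x) (w₃ := Mi) (w₂ := M) (Function.update k i false) hjl.symm
    (edgeAt_congr (by clear * - hi hj hl hij hil hjl; grind [Function.update_apply])) (edgeAt_congr (by clear * - hi hj hl hij hil hjl; grind [Function.update_apply]))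
    (edgeAt_congr (by clear * - hi hj hl hij hil hjl; grind [Function.update_apply])) (edgeAt_congr (by clear * - hi hj hl hij hil hjl; grind [Function.update_apply]))
    _ _ _ _ f₁ f₂ f₃ f₄]
  rw [complEdge_comm (x := x) (w₃ := Mj) (w₂ := M) (Function.update k j false) hil.symm
    (edgeAt_congr (by clear * - hi hj hl hij hil hjl; grind [Function.update_apply])) (edgeAt_congr (by clear * - hi hj hl hij hil hjl; grind [Function.update_apply]))
    (edgeAt_congr (by clear * - hi hj hl hij hil hjl; grind [Function.update_apply])) (edgeAt_congr (by clear * - hi hj hl hij hil hjl; grind [Function.update_apply]))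
    _ _ _ _ f₁ f₂ f₅ f₆]
  rw [Category.assoc, Category.assoc]
  congr 1
  exact complEdge_comm (x := x) (Function.update k l true) hij
    (edgeAt_congr (by clear * - hi hj hl hij hil hjl; grind [Function.update_apply])) (edgeAt_congr (by clear * - hi hj hl hij hil hjl; grind [Function.update_apply]))
    (edgeAt_congr (by clear * - hi hj hl hij hil hjl; grind [Function.update_apply])) (edgeAt_congr (by clear * - hi hj hl hij hil hjl; grind [Function.update_apply]))
    _ _ _ _ _ _ _ _

end Corner

/-! ### Extending representable functors over the corner -/

section Corner

variable {P : PrecubicalSet.{u}} {n : ℕ} {x : P.cells n} {k : Fin n → Bool}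

/-- The complement of the star of the corner `k` of `x`. -/
abbrev cornerCompl (P : PrecubicalSet.{u}) {n : ℕ} (k : Fin n → Bool) (x : P.cells n) :
    PrecubicalSet.{u} := (P.starComplement (P.corner k x)).toPrecubicalSet

/-- A vertex different from the corner `k` of `x`, as a vertex of the complement. -/
def toCornerCompl {b : P.cells 0} (hb : b ≠ P.corner k x) : (P.cornerCompl k x).cells 0 :=
  ⟨b, mem_starComplement.2 fun _ h => hb h⟩

theorem ne_corner (w : (P.cornerCompl k x).cells 0) : w.1 ≠ P.corner k x :=
  mem_starComplement.1 w.2 Fin.elim0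

/-- An edge at the corner lies in its star, hence in the cube, and regularity determines on which
side of the corner it lies. -/
theorem exists_eq_edgeAt (hx : P.IsRegular x)
    (hstar : ∀ m : ℕ, P.star (P.corner k x) m ⊆ P.cubeImage x m) {e : P.cells 1} {ε : Bool}
    (he : P.face ε 0 e = P.corner k x) : ∃ i, k i = ε ∧ e = P.edgeAt k i x := by
  have hs : e ∈ P.star (P.corner k x) 1 := mem_star.2 ⟨fun _ => ε, he⟩
  obtain ⟨c, rfl⟩ := hstar 1 hs
  obtain ⟨s, hs⟩ := (mem_star_corner_sharp hx c).1 hs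
  obtain ⟨i, hi⟩ := exists_edgeAt_of_sharp.{u} c s
  have h : sharp c P x = P.edgeAt k i x := by rw [hi, hs]
  change P.face ε 0 (sharp c P x) = _ at he
  rw [h, face_edgeAt] at he
  exact ⟨i, by simpa using (congrFun (hx.corner_injective he) i).symm, h⟩

theorem exists_isSquareAt_of_mem_star (hx : P.IsRegular x)
    (hstar : ∀ m : ℕ, P.star (P.corner k x) m ⊆ P.cubeImage x m) {z : P.cells 2}
    (hz : z ∈ P.star (P.corner k x) 2) : ∃ i j, i ≠ j ∧ P.IsSquareAt x k i j z := by
  obtain ⟨c, rfl⟩ := hstar 2 hz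
  obtain ⟨s, hs⟩ := (mem_star_corner_sharp hx c).1 hz
  obtain ⟨i, j, hij, h⟩ := exists_isSquareAt_of_sharp.{u} c s
  rw [hs] at h
  exact ⟨i, j, hij.ne, h P x⟩

theorem edgeAt_injective (hx : P.IsRegular x) {i j : Fin n}
    (h : P.edgeAt k i x = P.edgeAt k j x) : i = j := by
  by_contra hij
  have h1 := congrArg (P.face (!k i) 0) h
  rw [face_edgeAt, face_edgeAt] at h1
  have h2 := congrFun (hx.corner_injective h1) i
  simp [hij] at h2

theorem corner_update_ne (hx : P.IsRegular x) {i : Fin n} {ε : Bool} (h : k i ≠ ε) :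
    P.corner (Function.update k i ε) x ≠ P.corner k x := fun h' =>
  h (by simpa using (congrFun (hx.corner_injective h') i).symm)

/-- The value at the vertex `b` of the extension to the fundamental category of `P` of the covariant
functor represented by an object `A` of the fundamental category of the complement: at the corner,
it consists of the compatible families of morphisms to the ends of the edges that start there. -/
@[ext]
structure HomExtension (A : (P.cornerCompl k x).FundamentalCategory) (b : P.cells 0) where
  -- Vacuous at the corner, which is not a vertex of the complement; `out` is vacuous everywhere
  -- else.
  here : ∀ w : (P.cornerCompl k x).cells 0, w.1 = b → (A ⟶ (P.cornerCompl k x).toFundamental w)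
  out : b = P.corner k x → ∀ j, k j = false → ∀ w : (P.cornerCompl k x).cells 0,
    w.1 = P.corner (Function.update k j true) x → (A ⟶ (P.cornerCompl k x).toFundamental w)
  compat : ∀ (hb : b = P.corner k x) (i j : Fin n) (_ : i ≠ j) (hi : k i = false)
    (hj : k j = false) (wi wj w : (P.cornerCompl k x).cells 0)
    (hwi : wi.1 = P.corner (Function.update k i true) x)
    (hwj : wj.1 = P.corner (Function.update k j true) x)
    (h₁ : P.face false 0 (P.edgeAt (Function.update k i true) j x) = wi.1)
    (h₂ : P.face true 0 (P.edgeAt (Function.update k i true) j x) = w.1)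
    (h₃ : P.face false 0 (P.edgeAt (Function.update k j true) i x) = wj.1)
    (h₄ : P.face true 0 (P.edgeAt (Function.update k j true) i x) = w.1),
    out hb i hi wi hwi ≫ complEdge wi w _ h₁ h₂ = out hb j hj wj hwj ≫ complEdge wj w _ h₃ h₄

namespace HomExtension

variable {A : (P.cornerCompl k x).FundamentalCategory}

open Classical in
/-- The action of an edge. -/
noncomputable def act (hx : P.IsRegular x)
    (hstar : ∀ m : ℕ, P.star (P.corner k x) m ⊆ P.cubeImage x m) {b b' : P.cells 0}
    (e : P.cells 1) (he : P.face false 0 e = b) (he' : P.face true 0 e = b')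
    (φ : HomExtension A b) : HomExtension A b' where
  here w hw :=
    -- An edge leaving the corner selects its component of the family; any other edge acts by
    -- composition.
    if hb : b = P.corner k x then
      φ.out hb (exists_eq_edgeAt hx hstar (he.trans hb)).choose
        (exists_eq_edgeAt hx hstar (he.trans hb)).choose_spec.1 w (by
          rw [hw, ← he', ← face_edgeAt, ← (exists_eq_edgeAt hx hstar (he.trans hb)).choose_spec.2])
    else φ.here (toCornerCompl hb) rfl ≫ complEdge (toCornerCompl hb) w e he (he'.trans hw.symm)
  -- An edge entering the corner is continued along each outgoing edge by the detour; the resulting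
  -- family is compatible by `detour_comp`.
  out hb' j hj w hw :=
    φ.here (toCornerCompl (b := b) (by
        obtain ⟨i, hi, rfl⟩ := exists_eq_edgeAt hx hstar (he'.trans hb')
        rw [← he, face_edgeAt]
        exact corner_update_ne hx (by simp [hi]))) rfl ≫
      detour hx (exists_eq_edgeAt hx hstar (he'.trans hb')).choose_spec.1 hj _ w (by
        change b = _
        rw [← he, ← face_edgeAt, ← (exists_eq_edgeAt hx hstar (he'.trans hb')).choose_spec.2]) hw
  compat hb' i j hij hi hj wi wj w hwi hwj h₁ h₂ h₃ h₄ := by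
    rw [Category.assoc, Category.assoc, detour_comp hx _ hi hj hij _ wi wj w _ hwi hwj h₁ h₂ h₃ h₄]

variable (hx : P.IsRegular x) (hstar : ∀ m : ℕ, P.star (P.corner k x) m ⊆ P.cubeImage x m)
  {b b' : P.cells 0} (e : P.cells 1) (he : P.face false 0 e = b) (he' : P.face true 0 e = b')
  (φ : HomExtension A b)

theorem act_here_of_eq (hb : b = P.corner k x) {j : Fin n} (hj : k j = false)
    (hej : e = P.edgeAt k j x) (w : (P.cornerCompl k x).cells 0) (hw : w.1 = b')
    (hw' : w.1 = P.corner (Function.update k j true) x) :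
    (act hx hstar e he he' φ).here w hw = φ.out hb j hj w hw' := by
  have hex := exists_eq_edgeAt hx hstar (he.trans hb)
  have hj' : hex.choose = j := edgeAt_injective hx (hex.choose_spec.2.symm.trans hej)
  simp only [act, dif_pos hb]
  congr 1

theorem act_here_of_ne (wb w : (P.cornerCompl k x).cells 0) (hwb : wb.1 = b) (hw : w.1 = b')
    (h₁ : P.face false 0 e = wb.1) (h₂ : P.face true 0 e = w.1) :
    (act hx hstar e he he' φ).here w hw = φ.here wb hwb ≫ complEdge wb w e h₁ h₂ := by
  subst hwb
  simp only [act, dif_neg (ne_corner wb)]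
  rfl

theorem act_out (hb' : b' = P.corner k x) {i j : Fin n} (hi : k i = true) (hj : k j = false)
    (hei : e = P.edgeAt k i x) (wb w : (P.cornerCompl k x).cells 0) (hwb : wb.1 = b)
    (hw : w.1 = P.corner (Function.update k j true) x)
    (hwb' : wb.1 = P.corner (Function.update k i false) x) :
    (act hx hstar e he he' φ).out hb' j hj w hw =
      φ.here wb hwb ≫ detour hx hi hj wb w hwb' hw := by
  subst hwb
  have hex := exists_eq_edgeAt hx hstar (he'.trans hb')
  have hi' : hex.choose = i := edgeAt_injective hx (hex.choose_spec.2.symm.trans hei)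
  simp only [act]
  congr 1
  subst hi'
  rfl

variable {a c : P.cells 0} {e₁ e₂ g₁ g₂ : P.cells 1}

/-- If `k j = false`, the square starts at the corner and the claim is the compatibility of the
family. If `k j = true`, one side of the square passes through the corner, and entering and leaving
it gives the detour along the other side by construction. -/
theorem act_square_corner {i j : Fin n} (hij : i ≠ j)
    (he₁ : e₁ = P.edgeAt (Function.update k i false) j x)
    (he₂ : e₂ = P.edgeAt (Function.update k j true) i x)
    (hg₁ : g₁ = P.edgeAt (Function.update k j false) i x)
    (hg₂ : g₂ = P.edgeAt (Function.update k i true) j x)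
    (h₁ : P.face false 0 e₁ = a) (h₂ : P.face true 0 e₁ = b)
    (h₃ : P.face false 0 e₂ = b) (h₄ : P.face true 0 e₂ = c)
    (h₅ : P.face false 0 g₁ = a) (h₆ : P.face true 0 g₁ = b')
    (h₇ : P.face false 0 g₂ = b') (h₈ : P.face true 0 g₂ = c) (hi : k i = false)
    (ψ : HomExtension A a) :
    act hx hstar e₂ h₃ h₄ (act hx hstar e₁ h₁ h₂ ψ) =
      act hx hstar g₂ h₇ h₈ (act hx hstar g₁ h₅ h₆ ψ) := by
  subst he₁ he₂ hg₁ hg₂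
  have c₁ := (face_edgeAt _ _ _ _ _).symm.trans h₁
  have c₂ := (face_edgeAt _ _ _ _ _).symm.trans h₂
  have c₄ := (face_edgeAt _ _ _ _ _).symm.trans h₄
  have c₅ := (face_edgeAt _ _ _ _ _).symm.trans h₅
  have c₆ := (face_edgeAt _ _ _ _ _).symm.trans h₆
  have hc : c ≠ P.corner k x := by
    rw [← c₄]
    intro h
    simpa [hij, hi] using congrFun (hx.corner_injective h) i
  have hb' : b' ≠ P.corner k x := by
    rw [← c₆]
    intro h
    simpa [hij, hi] using congrFun (hx.corner_injective h) i
  have hki : Function.update k i false = k := by rw [← hi, Function.update_eq_self]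
  refine HomExtension.ext (funext fun w => funext fun hw => ?_) (funext fun h => absurd h hc)
  refine Eq.trans ?_ (act_here_of_ne hx hstar _ h₇ h₈ _ (toCornerCompl hb') w rfl hw h₇
    (h₈.trans hw.symm)).symm
  cases hj : k j with
  | false =>
    have hkj : Function.update k j false = k := by rw [← hj, Function.update_eq_self]
    have ha : a = P.corner k x := by rw [← c₁, hki, hkj]
    have hb : b ≠ P.corner k x := by
      rw [← c₂, hki]
      exact corner_update_ne hx (by simp [hj])
    refine (act_here_of_ne hx hstar _ h₃ h₄ _ (toCornerCompl hb) w rfl hw h₃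
      (h₄.trans hw.symm)).trans ?_
    refine (congrArg (· ≫ _) (act_here_of_eq hx hstar _ h₁ h₂ ψ ha hj (by rw [hki])
      (toCornerCompl hb) rfl (c₂.symm.trans (by rw [hki])))).trans ?_
    refine Eq.trans ?_ (congrArg (· ≫ _) (act_here_of_eq hx hstar _ h₅ h₆ ψ ha hi (by rw [hkj])
      (toCornerCompl hb') rfl (c₆.symm.trans (by rw [hkj])))).symm
    exact ψ.compat ha j i hij.symm hj hi _ _ _ _ _ _ _ _ _
  | true =>
    have hkj : Function.update k j true = k := by rw [← hj, Function.update_eq_self]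
    have hb : b = P.corner k x := by rw [← c₂, hki, hkj]
    have ha : a ≠ P.corner k x := by
      rw [← c₁, hki]
      exact corner_update_ne hx (by simp [hj])
    refine (act_here_of_eq hx hstar _ h₃ h₄ _ hb hi (by rw [hkj]) w hw
      (by rw [hw, ← c₄, hkj])).trans ?_
    refine (act_out hx hstar _ h₁ h₂ ψ hb hj hi (by rw [hki]) (toCornerCompl ha) w rfl _
      (c₁.symm.trans (by rw [hki]))).trans ?_
    refine Eq.trans ?_ (congrArg (· ≫ _) (act_here_of_ne hx hstar _ h₅ h₆ ψ (toCornerCompl ha)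
      (toCornerCompl hb') rfl rfl h₅ h₆)).symm
    refine Eq.trans ?_ (Category.assoc _ _ _).symm
    refine congrArg (_ ≫ ·) ?_
    subst c₆
    rfl

end HomExtension

end Corner

section Corner

variable {P : PrecubicalSet.{u}} {n : ℕ} {x : P.cells n} {k : Fin n → Bool}

namespace HomExtension

variable {A : (P.cornerCompl k x).FundamentalCategory}
  (hx : P.IsRegular x) (hstar : ∀ m : ℕ, P.star (P.corner k x) m ⊆ P.cubeImage x m)
  {a b b' c : P.cells 0} {e₁ e₂ g₁ g₂ : P.cells 1}

/-- The square ends at the corner, so families have to be compared; their components agree by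
`comp_detour`. -/
theorem act_square_end {i j : Fin n} (hij : i ≠ j)
    (he₁ : e₁ = P.edgeAt (Function.update k i false) j x)
    (he₂ : e₂ = P.edgeAt (Function.update k j true) i x)
    (hg₁ : g₁ = P.edgeAt (Function.update k j false) i x)
    (hg₂ : g₂ = P.edgeAt (Function.update k i true) j x)
    (h₁ : P.face false 0 e₁ = a) (h₂ : P.face true 0 e₁ = b)
    (h₃ : P.face false 0 e₂ = b) (h₄ : P.face true 0 e₂ = c)
    (h₅ : P.face false 0 g₁ = a) (h₆ : P.face true 0 g₁ = b')
    (h₇ : P.face false 0 g₂ = b') (h₈ : P.face true 0 g₂ = c) (hi : k i = true) (hj : k j = true)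
    (ψ : HomExtension A a) :
    act hx hstar e₂ h₃ h₄ (act hx hstar e₁ h₁ h₂ ψ) =
      act hx hstar g₂ h₇ h₈ (act hx hstar g₁ h₅ h₆ ψ) := by
  subst he₁ he₂ hg₁ hg₂
  have c₁ := (face_edgeAt _ _ _ _ _).symm.trans h₁
  have c₃ := (face_edgeAt _ _ _ _ _).symm.trans h₃
  have c₄ := (face_edgeAt _ _ _ _ _).symm.trans h₄
  have c₇ := (face_edgeAt _ _ _ _ _).symm.trans h₇
  have hki : Function.update k i true = k := by rw [← hi, Function.update_eq_self]
  have hkj : Function.update k j true = k := by rw [← hj, Function.update_eq_self]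
  have hc : c = P.corner k x := by rw [← c₄, hkj, hki]
  have ha : a ≠ P.corner k x := by
    rw [← c₁]
    intro h
    simpa [hj] using congrFun (hx.corner_injective h) j
  have hb : b ≠ P.corner k x := by
    rw [← c₃, hkj]
    exact corner_update_ne hx (by simp [hi])
  have hb' : b' ≠ P.corner k x := by
    rw [← c₇, hki]
    exact corner_update_ne hx (by simp [hj])
  refine HomExtension.ext (funext fun w => funext fun hw => absurd (hw.trans hc) (ne_corner w))
    (funext fun _ => funext fun l => funext fun hl => funext fun w => funext fun hw => ?_)
  refine (act_out hx hstar _ h₃ h₄ _ hc hi hl (by rw [hkj]) (toCornerCompl hb) w rfl hw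
    (c₃.symm.trans (by rw [hkj]))).trans ?_
  refine Eq.trans ?_ (act_out hx hstar _ h₇ h₈ _ hc hj hl (by rw [hki]) (toCornerCompl hb') w rfl hw
    (c₇.symm.trans (by rw [hki]))).symm
  refine (congrArg (· ≫ _) (act_here_of_ne hx hstar _ h₁ h₂ ψ (toCornerCompl ha)
    (toCornerCompl hb) rfl rfl h₁ h₂)).trans ?_
  refine Eq.trans ?_ (congrArg (· ≫ _) (act_here_of_ne hx hstar _ h₅ h₆ ψ (toCornerCompl ha)
    (toCornerCompl hb') rfl rfl h₅ h₆)).symm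
  refine (Category.assoc _ _ _).trans (Eq.trans ?_ (Category.assoc _ _ _).symm)
  exact congrArg (_ ≫ ·) (comp_detour hx hi hj hl hij _ _ _ _ _ _ _ _ _ _ _)

theorem act_square (z : P.cells 2) (he₁ : e₁ = P.face false 0 z) (he₂ : e₂ = P.face true 1 z)
    (hg₁ : g₁ = P.face false 1 z) (hg₂ : g₂ = P.face true 0 z)
    (h₁ : P.face false 0 e₁ = a) (h₂ : P.face true 0 e₁ = b)
    (h₃ : P.face false 0 e₂ = b) (h₄ : P.face true 0 e₂ = c)
    (h₅ : P.face false 0 g₁ = a) (h₆ : P.face true 0 g₁ = b')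
    (h₇ : P.face false 0 g₂ = b') (h₈ : P.face true 0 g₂ = c) (ψ : HomExtension A a) :
    act hx hstar e₂ h₃ h₄ (act hx hstar e₁ h₁ h₂ ψ) =
      act hx hstar g₂ h₇ h₈ (act hx hstar g₁ h₅ h₆ ψ) := by
  by_cases hz : z ∈ P.star (P.corner k x) 2
  · obtain ⟨i, j, hij, hsq⟩ := exists_isSquareAt_of_mem_star hx hstar hz
    have he₁' := he₁.trans (hsq false).1
    have he₂' := he₂.trans (hsq true).2
    have hg₁' := hg₁.trans (hsq false).2
    have hg₂' := hg₂.trans (hsq true).1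
    cases hi : k i with
    | false => exact act_square_corner hx hstar hij he₁' he₂' hg₁' hg₂' h₁ h₂ h₃ h₄ h₅ h₆ h₇ h₈ hi ψ
    | true =>
      cases hj : k j with
      | false =>
        exact (act_square_corner hx hstar hij.symm hg₁' hg₂' he₁' he₂' h₅ h₆ h₇ h₈ h₁ h₂ h₃ h₄
          hj ψ).symm
      | true =>
        exact act_square_end hx hstar hij he₁' he₂' hg₁' hg₂' h₁ h₂ h₃ h₄ h₅ h₆ h₇ h₈ hi hj ψ
  · have hcorner : ∀ s : Fin 2 → Bool, P.corner s z ≠ P.corner k x := mem_starComplement.1 hz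
    have ha : a ≠ P.corner k x := by rw [← h₁, he₁]; exact hcorner ![false, false]
    have hb : b ≠ P.corner k x := by rw [← h₂, he₁]; exact hcorner ![false, true]
    have hb' : b' ≠ P.corner k x := by rw [← h₇, hg₂]; exact hcorner ![true, false]
    have hc : c ≠ P.corner k x := by rw [← h₈, hg₂]; exact hcorner ![true, true]
    refine HomExtension.ext (funext fun w => funext fun hw => ?_) (funext fun h => absurd h hc)
    refine (act_here_of_ne hx hstar _ h₃ h₄ _ (toCornerCompl hb) w rfl hw h₃
      (h₄.trans hw.symm)).trans ?_
    refine Eq.trans ?_ (act_here_of_ne hx hstar _ h₇ h₈ _ (toCornerCompl hb') w rfl hw h₇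
      (h₈.trans hw.symm)).symm
    refine (congrArg (· ≫ _) (act_here_of_ne hx hstar _ h₁ h₂ ψ (toCornerCompl ha)
      (toCornerCompl hb) rfl rfl h₁ h₂)).trans ?_
    refine Eq.trans ?_ (congrArg (· ≫ _) (act_here_of_ne hx hstar _ h₅ h₆ ψ (toCornerCompl ha)
      (toCornerCompl hb') rfl rfl h₅ h₆)).symm
    refine (Category.assoc _ _ _).trans (Eq.trans ?_ (Category.assoc _ _ _).symm)
    exact congrArg (_ ≫ ·) (complEdge_square z he₁ he₂ hg₁ hg₂ _ _ _ _ _ _ _ _)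

/-- The action of a path. -/
noncomputable def actPath {a : P.Vertex} : ∀ {b : P.Vertex}, P.Path a b →
    HomExtension A a → HomExtension A b
  | _, .nil, φ => φ
  | _, .cons ω e, φ => act hx hstar e.1 e.2.1 e.2.2 (actPath ω φ)

theorem actPath_comp {a b c : P.Vertex} (ω : P.Path a b) (ν : P.Path b c)
    (φ : HomExtension A a) :
    actPath hx hstar (ω.comp ν) φ = actPath hx hstar ν (actPath hx hstar ω φ) := by
  induction ν with
  | nil => rfl
  | cons ν e ih =>
    rw [Quiver.Path.comp_cons, actPath, actPath, ih]

theorem actPath_eq_of_dihomotopyClass_eq {a b : P.Vertex} {ω ν : P.Path a b}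
    (h : P.dihomotopyClass ω = P.dihomotopyClass ν) (φ : HomExtension A a) :
    actPath hx hstar ω φ = actPath hx hstar ν φ := by
  have h' := (CategoryTheory.Quotient.functor_homRel_eq_compClosure_eqvGen P.SquareRel
    (X := (a : Paths P.Vertex)) (Y := b) ω ν).1 h
  clear h
  induction h' with
  | refl => rfl
  | symm _ _ _ ih => exact ih.symm
  | trans _ _ _ _ _ ih₁ ih₂ => exact ih₁.trans ih₂
  | rel ω ν hr =>
    obtain ⟨s, t, f, m₁, m₂, g, hm⟩ := hr
    have key : ∀ ψ : HomExtension A s, actPath hx hstar (a := s) (b := t) m₁ ψ = actPath hx hstar m₂ ψ := by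
      obtain ⟨z, e₁, e₂, g₁, g₂, he₁, he₂, hg₁, hg₂⟩ := hm
      exact fun ψ => act_square hx hstar z he₁ he₂ hg₁ hg₂ _ _ _ _ _ _ _ _ ψ
    have hcomp : ∀ (s t : P.Vertex) (f : P.Path a s) (m : P.Path s t) (g : P.Path t b),
        actPath hx hstar (f.comp (m.comp g)) φ =
          actPath hx hstar g (actPath hx hstar m (actPath hx hstar f φ)) := by
      intro s t f m g
      rw [actPath_comp, actPath_comp]
    exact (hcomp s t f m₁ g).trans ((congrArg _ (key _)).trans (hcomp s t f m₂ g).symm)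

/-- The extension given by the identity of a vertex of the complement. -/
def ofVertex (a : (P.cornerCompl k x).cells 0) :
    HomExtension ((P.cornerCompl k x).toFundamental a) a.1 where
  here _ hw := eqToHom (congrArg (P.cornerCompl k x).toFundamental (Subtype.ext hw.symm))
  out hb := absurd hb (ne_corner a)
  compat hb := absurd hb (ne_corner a)

/-- All edges of the path avoid the corner, so each acts by composition with its class in the
complement. -/
theorem actPath_mapPath_ofVertex {a b : (P.cornerCompl k x).Vertex}
    (ω : (P.cornerCompl k x).Path a b) :
    (actPath hx hstar ((P.starComplement (P.corner k x)).incl.prefunctor.mapPath ω)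
      (ofVertex a)).here b rfl = (P.cornerCompl k x).dihomotopyClass ω := by
  induction ω with
  | nil => rfl
  | cons ω e ih =>
    rw [dihomotopyClass_cons, ← ih]
    exact act_here_of_ne hx hstar _ _ _ _ _ _ rfl rfl (congrArg Subtype.val e.2.1)
      (congrArg Subtype.val e.2.2)

end HomExtension

/-! ### The inclusion is fully faithful on fundamental categories -/

/-- The functor between fundamental categories given by a morphism of precubical sets. -/
def Hom.fundamentalFunctor {P Q : PrecubicalSet.{u}} (f : Hom P Q) :
    P.FundamentalCategory ⥤ Q.FundamentalCategory :=
  CategoryTheory.Quotient.lift P.SquareRel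
    { obj := fun a => Q.toFundamental (f.app (P := P) (n := 0) a)
      map := fun {a b} ω => Q.dihomotopyClass (f.prefunctor.mapPath (V := P.Vertex) (a := a) (b := b) ω)
      map_id := fun _ => rfl
      map_comp := fun {a b c} ω ν => by
        refine (congrArg _ (f.prefunctor.mapPath_comp (V := P.Vertex) ω ν)).trans ?_
        exact Q.dihomotopyClass_comp _ _ }
    (by
      rintro _ _ _ _ ⟨z, e₁, e₂, g₁, g₂, he₁, he₂, hg₁, hg₂⟩
      exact Q.edgeClass_square (f.app z) ((congrArg _ he₁).trans (f.app_face _ _ _))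
        ((congrArg _ he₂).trans (f.app_face _ _ _)) ((congrArg _ hg₁).trans (f.app_face _ _ _))
        ((congrArg _ hg₂).trans (f.app_face _ _ _))
        (f.prefunctor.map e₁).2.1 (f.prefunctor.map e₁).2.2
        (f.prefunctor.map e₂).2.1 (f.prefunctor.map e₂).2.2
        (f.prefunctor.map g₁).2.1 (f.prefunctor.map g₁).2.2
        (f.prefunctor.map g₂).2.1 (f.prefunctor.map g₂).2.2)

theorem exists_dihomotopyClass (P : PrecubicalSet.{u}) {a b : P.FundamentalCategory} (g : a ⟶ b) :
    ∃ ω : P.Path (a.as : P.Vertex) b.as, P.dihomotopyClass ω = g := by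
  obtain ⟨ω, rfl⟩ := (CategoryTheory.Quotient.functor P.SquareRel).map_surjective
    (X := a.as) (Y := b.as) g
  exact ⟨ω, rfl⟩

/-- The class in the complement is recovered from the action on the identity, and this action
depends only on the class in `P`. -/
theorem faithful_fundamentalFunctor_incl (hx : P.IsRegular x)
    (hstar : ∀ m : ℕ, P.star (P.corner k x) m ⊆ P.cubeImage x m) :
    (P.starComplement (P.corner k x)).incl.fundamentalFunctor.Faithful := by
  refine ⟨fun {a b} f g h => ?_⟩
  obtain ⟨ω, rfl⟩ := exists_dihomotopyClass _ f
  obtain ⟨ν, rfl⟩ := exists_dihomotopyClass _ g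
  refine (HomExtension.actPath_mapPath_ofVertex hx hstar ω).symm.trans
    (Eq.trans ?_ (HomExtension.actPath_mapPath_ofVertex hx hstar ν))
  exact congrArg (fun φ : HomExtension _ _ => φ.here b.as rfl)
    (HomExtension.actPath_eq_of_dihomotopyClass_eq hx hstar h _)

theorem edgeClass_comm (y : P.cells n) (s : Fin n → Bool) {i j : Fin n} (hij : i ≠ j)
    {a b b' c : P.cells 0} {e₁ e₂ g₁ g₂ : P.cells 1}
    (he₁ : e₁ = P.edgeAt (Function.update s i false) j y)
    (he₂ : e₂ = P.edgeAt (Function.update s j true) i y)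
    (hg₁ : g₁ = P.edgeAt (Function.update s j false) i y)
    (hg₂ : g₂ = P.edgeAt (Function.update s i true) j y)
    (h₁ : P.face false 0 e₁ = a) (h₂ : P.face true 0 e₁ = b)
    (h₃ : P.face false 0 e₂ = b) (h₄ : P.face true 0 e₂ = c)
    (h₅ : P.face false 0 g₁ = a) (h₆ : P.face true 0 g₁ = b')
    (h₇ : P.face false 0 g₂ = b') (h₈ : P.face true 0 g₂ = c) :
    P.edgeClass e₁ h₁ h₂ ≫ P.edgeClass e₂ h₃ h₄ = P.edgeClass g₁ h₅ h₆ ≫ P.edgeClass g₂ h₇ h₈ := by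
  rcases lt_or_gt_of_ne hij with h | h
  · obtain ⟨z, hz⟩ := P.exists_isSquareAt y s h
    exact P.edgeClass_square z (he₁.trans (hz false).1.symm) (he₂.trans (hz true).2.symm)
      (hg₁.trans (hz false).2.symm) (hg₂.trans (hz true).1.symm) _ _ _ _ _ _ _ _
  · obtain ⟨z, hz⟩ := P.exists_isSquareAt y s h
    exact (P.edgeClass_square z (hg₁.trans (hz false).1.symm) (hg₂.trans (hz true).2.symm)
      (he₁.trans (hz false).2.symm) (he₂.trans (hz true).1.symm) _ _ _ _ _ _ _ _).symm

theorem fundamentalFunctor_map_detour (hx : P.IsRegular x) {i j : Fin n} (hi : k i = true)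
    (hj : k j = false) (w w' : (P.cornerCompl k x).cells 0)
    (hw : w.1 = P.corner (Function.update k i false) x)
    (hw' : w'.1 = P.corner (Function.update k j true) x)
    (h₁ : P.face false 0 (P.edgeAt (Function.update k i false) j x) = w.1)
    (h₂ : P.face true 0 (P.edgeAt (Function.update k i false) j x) =
      P.corner (Function.update (Function.update k i false) j true) x)
    (h₃ : P.face false 0 (P.edgeAt (Function.update k j true) i x) =
      P.corner (Function.update (Function.update k i false) j true) x)
    (h₄ : P.face true 0 (P.edgeAt (Function.update k j true) i x) = w'.1) :
    (P.starComplement (P.corner k x)).incl.fundamentalFunctor.map (detour hx hi hj w w' hw hw') =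
      P.edgeClass (P.edgeAt (Function.update k i false) j x) h₁ h₂ ≫
        P.edgeClass (P.edgeAt (Function.update k j true) i x) h₃ h₄ := rfl

/-- Up to dihomotopy, a path that starts outside the corner avoids the corner, except possibly at its
end. -/
theorem exists_map_eq_dihomotopyClass (hx : P.IsRegular x)
    (hstar : ∀ m : ℕ, P.star (P.corner k x) m ⊆ P.cubeImage x m)
    (a : (P.cornerCompl k x).cells 0) {b : P.Vertex} (ω : P.Path (a.1 : P.Vertex) b) :
    (∃ (w : (P.cornerCompl k x).cells 0) (hw : w.1 = b)
      (ψ : (P.cornerCompl k x).toFundamental a ⟶ (P.cornerCompl k x).toFundamental w),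
      (P.starComplement (P.corner k x)).incl.fundamentalFunctor.map ψ ≫
        eqToHom (congrArg P.toFundamental hw) = P.dihomotopyClass ω) ∨
    (∃ (_ : b = P.corner k x) (w : (P.cornerCompl k x).cells 0)
      (ψ : (P.cornerCompl k x).toFundamental a ⟶ (P.cornerCompl k x).toFundamental w)
      (e : P.cells 1) (h : P.face false 0 e = w.1) (h' : P.face true 0 e = b),
      (P.starComplement (P.corner k x)).incl.fundamentalFunctor.map ψ ≫ P.edgeClass e h h' =
        P.dihomotopyClass ω) := by
  induction ω with
  | nil => exact Or.inl ⟨a, rfl, 𝟙 _, rfl⟩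
  | @cons b c ω e ih =>
    obtain ⟨e, he, he'⟩ := e
    rcases ih with ⟨w, hw, ψ, hψ⟩ | ⟨hb, w, ψ, e', h, h', hψ⟩
    · subst hw
      by_cases hc : c = P.corner k x
      · refine Or.inr ⟨hc, w, ψ, e, he, he', ?_⟩
        rw [dihomotopyClass_cons, ← hψ]
        exact congrArg (· ≫ _) (Category.comp_id _).symm
      · refine Or.inl ⟨toCornerCompl hc, rfl, ψ ≫ complEdge w (toCornerCompl hc) e he he', ?_⟩
        rw [dihomotopyClass_cons, ← hψ, Functor.map_comp]
        refine (Category.comp_id _).trans ?_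
        exact congrArg₂ (· ≫ ·) (Category.comp_id _).symm rfl
    -- The path has arrived at the corner along direction i and leaves it along j. The square of x
    -- in these directions replaces the two edges by the detour.
    · obtain ⟨i, hi, rfl⟩ := exists_eq_edgeAt hx hstar (h'.trans hb)
      obtain ⟨j, hj, rfl⟩ := exists_eq_edgeAt hx hstar (he.trans hb)
      have hij : i ≠ j := fun h => by simp [h, hj] at hi
      have hki : Function.update k i true = k := by rw [← hi, Function.update_eq_self]
      have hkj : Function.update k j false = k := by rw [← hj, Function.update_eq_self]
      have hw : w.1 = P.corner (Function.update k i false) x := h.symm.trans (face_edgeAt _ _ _ _ _)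
      have hc : P.corner (Function.update k j true) x = c := (face_edgeAt _ _ _ _ _).symm.trans he'
      have hcv : c ≠ P.corner k x := hc ▸ corner_update_ne hx (by simp [hj])
      refine Or.inl ⟨toCornerCompl hcv, rfl, ψ ≫ detour hx hi hj w (toCornerCompl hcv) hw hc.symm, ?_⟩
      rw [dihomotopyClass_cons, ← hψ, Functor.map_comp, Category.assoc]
      refine Eq.trans ?_ (Category.assoc _ _ _).symm
      refine congrArg ((P.starComplement (P.corner k x)).incl.fundamentalFunctor.map ψ ≫ ·) ?_
      refine (Category.comp_id _).trans ?_
      refine (fundamentalFunctor_map_detour hx hi hj w (toCornerCompl hcv) hw hc.symm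
        (by rw [hw, face_edgeAt, Function.update_comm hij, hkj]) (face_edgeAt _ _ _ _ _)
        (by rw [face_edgeAt, Function.update_comm hij.symm])
        ((face_edgeAt _ _ _ _ _).trans (by rw [Function.update_comm hij.symm, hki, hc]; rfl))).trans ?_
      exact edgeClass_comm x k hij rfl rfl (by rw [hkj]) (by rw [hki]) _ _ _ _ _ _ _ _

theorem full_fundamentalFunctor_incl (hx : P.IsRegular x)
    (hstar : ∀ m : ℕ, P.star (P.corner k x) m ⊆ P.cubeImage x m) :
    (P.starComplement (P.corner k x)).incl.fundamentalFunctor.Full := by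
  refine ⟨fun {a b} g => ?_⟩
  obtain ⟨ω, rfl⟩ := exists_dihomotopyClass _ g
  rcases exists_map_eq_dihomotopyClass hx hstar a.as ω with ⟨w, hw, ψ, hψ⟩ | ⟨hb, -⟩
  · obtain rfl : w = b.as := Subtype.ext hw
    exact ⟨ψ, (Category.comp_id _).symm.trans hψ⟩
  · exact absurd hb (ne_corner (P := P) (x := x) b.as)

theorem reach_of_reach_incl (hx : P.IsRegular x)
    (hstar : ∀ m : ℕ, P.star (P.corner k x) m ⊆ P.cubeImage x m)
    (a b : (P.cornerCompl k x).cells 0) (h : P.Reach a.1 b.1) : (P.cornerCompl k x).Reach a b := by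
  obtain ⟨ω⟩ := h
  have := full_fundamentalFunctor_incl hx hstar
  obtain ⟨ψ, -⟩ := (P.starComplement (P.corner k x)).incl.fundamentalFunctor.map_surjective
    (X := (P.cornerCompl k x).toFundamental a) (Y := (P.cornerCompl k x).toFundamental b)
    (P.dihomotopyClass ω)
  obtain ⟨ν, -⟩ := exists_dihomotopyClass _ ψ
  exact ⟨ν⟩

end Corner

/-! ### The inclusion of a precubical subset as a weak morphism -/

/-- The composite of two morphisms of precubical sets. -/
def Hom.comp {P : PrecubicalSet.{u}} {Q : PrecubicalSet.{v}} {S : PrecubicalSet.{w}} (g : Hom Q S)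
    (f : Hom P Q) : Hom P S where
  app x := g.app (f.app x)
  app_face ε i x := by rw [f.app_face, g.app_face]

/-- A morphism of precubical sets as a weak morphism. -/
def Hom.weakMorphism {P Q : PrecubicalSet.{u}} (f : Hom P Q) : WeakMorphism P Q where
  map := f.realization
  vertexMap a := f.app a
  map_vertex _ := rfl
  exists_grid n k _ hk ξ := by
    refine ⟨k, f.comp ξ, Homeomorph.refl _, hk, fun _ _ => Iff.rfl, fun s => ?_⟩
    induction s using Quot.inductionOn
    rfl

theorem Hom.length_mapPath {P Q : PrecubicalSet.{u}} (f : Hom P Q) {a b : P.Vertex}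
    (ω : P.Path a b) : (f.prefunctor.mapPath ω).length = ω.length := by
  induction ω with
  | nil => rfl
  | cons ω e ih => exact congrArg (· + 1) ih

theorem Hom.realization_pathRealization {P Q : PrecubicalSet.{u}} (f : Hom P Q) {a b : P.Vertex}
    (ω : P.Path a b) (t : ℝ) : f.realization (P.pathRealization ω t) =
      Q.pathRealization (f.prefunctor.mapPath ω) t := by
  induction ω with
  | nil => rfl
  | cons ω e ih =>
    simp only [pathRealization, Prefunctor.mapPath_cons]
    rw [f.length_mapPath ω, ← ih]
    split_ifs <;> rfl

/-- The map of paths given by a morphism of precubical sets. -/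
def Hom.pathMap {P Q : PrecubicalSet.{u}} (f : Hom P Q) : PathMap f.weakMorphism where
  map ω := f.prefunctor.mapPath ω
  spec ω := by
    refine ⟨Homeomorph.setCongr (by rw [← f.length_mapPath ω]; rfl), fun s t => Iff.rfl, fun t => ?_⟩
    exact f.realization_pathRealization ω t

theorem Hom.isFunctorial_pathMap {P Q : PrecubicalSet.{u}} (f : Hom P Q) :
    f.pathMap.IsFunctorial where
  map_nil _ := rfl
  map_comp ω ν := f.prefunctor.mapPath_comp ω ν
  map_dihomotopy _ _ h := congrArg (fun g => f.fundamentalFunctor.map g) h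

/-- Bijectivity on objects upgrades an equivalence to an isomorphism; the inverse on morphisms is
the preimage after transport along the object equalities. -/
theorem exists_strict_inverse {C D : Type*} [Category* C] [Category* D] (F : C ⥤ D) [F.Full]
    [F.Faithful] (hF : Function.Bijective F.obj) : ∃ G : D ⥤ C, F ⋙ G = 𝟭 C ∧ G ⋙ F = 𝟭 D := by
  obtain ⟨g, hgF, hFg⟩ := Function.bijective_iff_has_inverse.1 hF
  let G : D ⥤ C :=
    { obj := g
      map := fun {X Y} f => F.preimage (eqToHom (hFg X) ≫ f ≫ eqToHom (hFg Y).symm)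
      map_id := fun X => F.map_injective (by simp)
      map_comp := fun f h => F.map_injective (by simp) }
  refine ⟨G, CategoryTheory.Functor.ext hgF fun X Y f => F.map_injective ?_,
    CategoryTheory.Functor.ext hFg fun X Y f => ?_⟩
  · simp [G, eqToHom_map]
  · simp [G]

/-! ### Extremal vertices and accessibility -/

section Corner

variable {P : PrecubicalSet.{u}} {n : ℕ} {x : P.cells n} {k : Fin n → Bool}

theorem exists_reach_corner (hk1 : ∃ i, k i = true) (hx : P.IsRegular x) :
    ∃ w : (P.cornerCompl k x).cells 0, P.Reach w.1 (P.corner k x) := by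
  obtain ⟨i, hi⟩ := hk1
  refine ⟨toCornerCompl (corner_update_ne hx (i := i) (ε := false) (by simp [hi])), ?_⟩
  have h := P.reach_edge (P.edgeAt k i x)
  rw [face_edgeAt, face_edgeAt, ← hi, Function.update_eq_self] at h
  exact h

theorem exists_corner_reach (hk0 : ∃ i, k i = false) (hx : P.IsRegular x) :
    ∃ w : (P.cornerCompl k x).cells 0, P.Reach (P.corner k x) w.1 := by
  obtain ⟨i, hi⟩ := hk0
  refine ⟨toCornerCompl (corner_update_ne hx (i := i) (ε := true) (by simp [hi])), ?_⟩
  have h := P.reach_edge (P.edgeAt k i x)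
  rw [face_edgeAt, face_edgeAt, ← hi, Function.update_eq_self] at h
  exact h

/-- A vertex outside the corner `k` that is the end `ε` of an edge is the end `ε` of an edge that
avoids the corner. -/
theorem exists_edge_compl_iff (hx : P.IsRegular x)
    (hstar : ∀ m : ℕ, P.star (P.corner k x) m ⊆ P.cubeImage x m) (hk : ∀ ε, ∃ i, k i = ε) (ε : Bool)
    (w : (P.cornerCompl k x).cells 0) :
    (∃ e, (P.cornerCompl k x).face ε 0 e = w) ↔ ∃ e, P.face ε 0 e = w.1 := by
  constructor
  · rintro ⟨e, he⟩
    exact ⟨e.1, congrArg Subtype.val he⟩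
  · rintro ⟨e, he⟩
    have key : ∀ e : P.cells 1, P.face ε 0 e = w.1 → P.face (!ε) 0 e ≠ P.corner k x →
        ∃ e, (P.cornerCompl k x).face ε 0 e = w := by
      intro e h h'
      refine ⟨⟨e, mem_starComplement.2 fun s => ?_⟩, Subtype.ext h⟩
      rw [corner_succ]
      rcases Bool.eq_or_eq_not (s 0) ε with hs | hs
      · rw [hs, h]; exact ne_corner w
      · rw [hs]; exact h'
    by_cases h : P.face (!ε) 0 e = P.corner k x
    -- Here w is the neighbour of the corner in direction i. A direction j with `k j = ε` gives
    -- another edge of x with end `ε` at w; both its ends differ from the corner in coordinate i.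
    · obtain ⟨i, hi, rfl⟩ := exists_eq_edgeAt hx hstar h
      obtain ⟨j, hj⟩ := hk ε
      have hij : i ≠ j := fun h => by subst h; cases ε <;> simp_all
      rw [face_edgeAt] at he
      refine key (P.edgeAt (Function.update k i ε) j x) ?_ ?_
      · rw [face_edgeAt, ← he]
        congr 1
        rw [Function.update_eq_self_iff, Function.update_of_ne hij.symm, hj]
      · rw [face_edgeAt]
        intro h'
        have := congrFun (hx.corner_injective h') i
        rw [Function.update_of_ne hij, Function.update_self, hi] at this
        cases ε <;> simp at this
    · exact key e he h

theorem exists_edge_corner (hk : ∀ ε, ∃ i, k i = ε) (ε : Bool) :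
    ∃ e, P.face ε 0 e = P.corner k x := by
  obtain ⟨i, hi⟩ := hk ε
  exact ⟨P.edgeAt k i x, by rw [face_edgeAt, ← hi, Function.update_eq_self]⟩

/-- The corner is an end of both kinds of some edge of x, so it is not extremal, and deleting its
star does not change which other vertices are. -/
theorem image_vertices_not_end (hx : P.IsRegular x)
    (hstar : ∀ m : ℕ, P.star (P.corner k x) m ⊆ P.cubeImage x m) (hk : ∀ ε, ∃ i, k i = ε)
    (ε : Bool) :
    (fun w : (P.cornerCompl k x).cells 0 => w.1) ''
      {w | ¬ ∃ e, (P.cornerCompl k x).face ε 0 e = w} = {a | ¬ ∃ e, P.face ε 0 e = a} := by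
  ext a
  constructor
  · rintro ⟨w, hw, rfl⟩
    exact fun h => hw ((exists_edge_compl_iff hx hstar hk ε w).2 h)
  · intro ha
    have hav : a ≠ P.corner k x := by
      rintro rfl
      exact ha (exists_edge_corner hk ε)
    exact ⟨toCornerCompl hav, fun h => ha ((exists_edge_compl_iff hx hstar hk ε _).1 h), rfl⟩

end Corner

end PrecubicalSet

/-! ### The theorem for higher-dimensional automata -/

namespace HDA

variable {M : Type v} [Monoid M]

/-- The inclusion of the restriction of an HDA to a precubical subset. -/
def restrictIncl (A : HDA.{u} M) (X : A.P.Subset) : WeakMorphism (A.restrict X) A where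
  toWeakMorphism := X.incl.weakMorphism
  pathMap := X.incl.pathMap
  map_init _ h := h
  map_final _ h := h
  map_label ω := by
    induction ω with
    | nil => rfl
    | cons ω e ih => exact congrArg (· * _) ih

theorem image_restrictIncl {A : HDA.{u} M} {X : A.P.Subset} {S : Set (A.P.cells 0)}
    (h : S ⊆ X.carrier 0) :
    (A.restrictIncl X).vertexMap '' {a | X.incl.app a ∈ S} = S := by
  ext a
  exact ⟨by rintro ⟨b, hb, rfl⟩; exact hb, fun ha => ⟨⟨a, h ha⟩, ha, rfl⟩⟩

end HDA

theorem theorem5p4 {M : Type v} [Monoid M] (R : Type w) [CommRing R] (A : HDA.{u} M)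
    (n : ℕ) (hn : 2 ≤ n) (x : A.P.cells n) (hx : A.P.IsRegular x)
    (k : Fin n → Bool) (hk0 : ∃ i, k i = false) (hk1 : ∃ i, k i = true)
    (hv : A.P.corner k x ∉ A.init ∪ A.final)
    (hstar : ∀ m : ℕ, A.P.star (A.P.corner k x) m ⊆ A.P.cubeImage x m) :
    HDA.IsTopologicalAbstraction R (A.restrict (A.P.starComplement (A.P.corner k x))) A ∧
      (A.IsAccessible ↔
        (A.restrict (A.P.starComplement (A.P.corner k x))).IsAccessible) ∧
      (A.IsCoaccessible ↔
        (A.restrict (A.P.starComplement (A.P.corner k x))).IsCoaccessible) := by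
  have hk : ∀ ε, ∃ i, k i = ε := fun ε => by cases ε <;> assumption
  have hreach := reach_of_reach_incl hx hstar
  have hinit : A.init ⊆ (A.P.starComplement (A.P.corner k x)).carrier 0 := fun a ha =>
    mem_starComplement.2 fun _ h => hv (Or.inl (h ▸ ha))
  have hfinal : A.final ⊆ (A.P.starComplement (A.P.corner k x)).carrier 0 := fun a ha =>
    mem_starComplement.2 fun _ h => hv (Or.inr (h ▸ ha))
  have hmax := image_vertices_not_end hx hstar hk false
  have hmin := image_vertices_not_end hx hstar hk true
  refine ⟨⟨A.restrictIncl _, HDA.image_restrictIncl hinit, HDA.image_restrictIncl hfinal, hmax, hmin,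
    -- For the homotopy equivalence alone, any direction of the push will do.
    exists_homotopyEquiv hx hstar hk1.choose, ⟨Hom.isFunctorial_pathMap _, ?_, ?_⟩,
    isHomologyGraphIso_incl R hx hstar hk0 hk1 hreach⟩, ⟨?_, ?_⟩, ⟨?_, ?_⟩⟩
  · rintro a (((ha | ha) | ha) | ha)
    · exact Or.inl (Or.inl (Or.inl ha))
    · exact Or.inl (Or.inl (Or.inr ha))
    · exact Or.inl (Or.inr (hmax.subset ⟨a.as, ha, rfl⟩))
    · exact Or.inr (hmin.subset ⟨a.as, ha, rfl⟩)
  · have hfull := full_fundamentalFunctor_incl hx hstar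
    have hfaith := faithful_fundamentalFunctor_incl hx hstar
    -- Fullness and faithfulness pass to the full subcategories; on objects, surjectivity holds
    -- because initial, final and extremal vertices of `A` all lie in the complement.
    refine @exists_strict_inverse _ _ _ _ _ ⟨fun {a b} g => ?_⟩ ⟨fun {a b} g h e => ?_⟩ ⟨?_, ?_⟩
    · obtain ⟨ψ, hψ⟩ := hfull.map_surjective g.hom
      exact ⟨ObjectProperty.homMk ψ, ObjectProperty.hom_ext _ hψ⟩
    · exact ObjectProperty.hom_ext _ (hfaith.map_injective (congrArg (fun f => f.hom) e))
    · intro a b h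
      have h' := congrArg (fun a => (a.obj.as : A.P.cells 0)) h
      exact ObjectProperty.FullSubcategory.ext
        (CategoryTheory.Quotient.ext (Subtype.ext h'))
    · rintro ⟨⟨a⟩, ((ha | ha) | ha) | ha⟩
      · exact ⟨⟨⟨⟨a, hinit ha⟩⟩, Or.inl (Or.inl (Or.inl ha))⟩, rfl⟩
      · exact ⟨⟨⟨⟨a, hfinal ha⟩⟩, Or.inl (Or.inl (Or.inr ha))⟩, rfl⟩
      · obtain ⟨w, hw, rfl⟩ := hmax.superset ha
        exact ⟨⟨⟨w⟩, Or.inl (Or.inr hw)⟩, rfl⟩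
      · obtain ⟨w, hw, rfl⟩ := hmin.superset ha
        exact ⟨⟨⟨w⟩, Or.inr hw⟩, rfl⟩
  · intro h w
    obtain ⟨a, ha, har⟩ := h w.1
    exact ⟨⟨a, hinit ha⟩, ha, hreach _ _ har⟩
  · intro h b
    have key : ∀ w : (A.P.cornerCompl k x).cells 0, ∃ a ∈ A.init, A.P.Reach a w.1 := fun w => by
      obtain ⟨a, ha, har⟩ := h w
      exact ⟨a.1, ha, har.map (A.P.starComplement (A.P.corner k x)).incl⟩
    -- The corner is accessible through a predecessor in the complement.
    by_cases hb : b = A.P.corner k x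
    · obtain ⟨w, hw⟩ := exists_reach_corner hk1 hx
      obtain ⟨a, ha, har⟩ := key w
      exact ⟨a, ha, hb ▸ har.trans hw⟩
    · exact key (toCornerCompl hb)
  · intro h w
    obtain ⟨a, ha, har⟩ := h w.1
    exact ⟨⟨a, hfinal ha⟩, ha, hreach _ _ har⟩
  · intro h b
    have key : ∀ w : (A.P.cornerCompl k x).cells 0, ∃ a ∈ A.final, A.P.Reach w.1 a := fun w => by
      obtain ⟨a, ha, har⟩ := h w
      exact ⟨a.1, ha, har.map (A.P.starComplement (A.P.corner k x)).incl⟩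
    by_cases hb : b = A.P.corner k x
    · obtain ⟨w, hw⟩ := exists_corner_reach hk0 hx
      obtain ⟨a, ha, har⟩ := key w
      exact ⟨a, ha, hb ▸ hw.trans har⟩
    · exact key (toCornerCompl hb)
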